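/- Let $A$ be a ring with identity, and for a ring $R$ let $\mathrm{mod}\text{-}R$ be the category of finitely presented right $R$-modules, so that $\mathrm{mod}\text{-}A^{op}$ is the category of finitely presented left $A$-modules. Let $\mathrm{mod}\text{-}(\mathrm{mod}\text{-}R)$ be the category of finitely presented functors $F:\mathrm{mod}\text{-}R\to\mathrm{Ab}$, i.e. those admitting a sequence $\mathrm{Hom}_R(Y,-)\to\mathrm{Hom}_R(X,-)\to F\to 0$ with $X,Y\in\mathrm{mod}\text{-}R$ that is exact at every object. Let $\mathbb{R}$ be the additive category with objects $R^n$ $(n\ge 0)$ and $\mathrm{Hom}(R^n,R^m)=\mathrm{Mat}_{m\times n}(R)$, matrices acting from the left on column vectors. Let $\mathrm{III}(\mathbb{R})$ be Adelman's category: its objects are chains $R^m\xrightarrow{u}R^n\xrightarrow{v}R^p$ (with no condition on $vu$), its morphisms are commutative diagrams $(\alpha_1,\alpha_2,\alpha_3)$ from $(u,v)$ to $(u',v')$ modulo those with $\alpha_2=u's+tv$ for some matrices $s,t$. Let $$\mathfrak{k}_R:\big(\mathrm{mod}\text{-}(\mathrm{mod}\text{-}R)\big)^{op}\to\mathrm{III}(\mathbb{R})$$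 be the equivalence whose quasi-inverse $\mathfrak{k}_R^{-1}$ sends a chain $(u,v)$ to the cokernel of the natural transformation $\mathrm{Hom}_R(\mathrm{Coker}(vu),-)\to\mathrm{Hom}_R(\mathrm{Coker}\,u,-)$ given by composition with the homomorphism $\mathrm{Coker}\,u\to\mathrm{Coker}(vu)$ induced by $v$, and sends a morphism of chains to the induced morphism of cokernels. Let $d:\mathrm{mod}\text{-}(\mathrm{mod}\text{-}A)\to\mathrm{mod}\text{-}(\mathrm{mod}\text{-}A^{op})$ be the (contravariant) Auslander–Gruson–Jensen duality: if $F$ has a projective presentation $\mathrm{Hom}_A(Y,-)\xrightarrow{\mathrm{Hom}_A(f,-)}\mathrm{Hom}_A(X,-)\to F\to 0$, then $dF=\mathrm{Ker}\big(X\otimes_A-\xrightarrow{f\otimes_A-}Y\otimes_A-\big)$, and $d$ acts on morphisms by lifting them to the presentations and passing to the induced morphisms of kernels. Let $d_{\mathrm{III}}:\mathrm{III}(\mathbb{A})\to\mathrm{III}(\mathbb{A}^{op})$, where $\mathrm{III}(\mathbb{A}^{op})$ denotes Adelman's category for the ring $A^{op}$, be the contravariant functor that reverses all arrows and replaces left multiplication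 by a matrix on column vectors by right multiplication by the same matrix on row vectors; equivalently, each matrix over $A$ is replaced by its transpose, regarded as a matrix over $A^{op}$. Then there is a natural isomorphism $$d_{\mathrm{III}}\circ\mathfrak{k}_A\;\cong\;\mathfrak{k}_{A^{op}}\circ d .$$ -/

import Mathlib

open CategoryTheory CategoryTheory.Limits Opposite

universe v u

noncomputable section

namespace AGJ

section FinitelyPresentedFunctors

variable {C : Type u} [Category.{v} C]

theorem cokernel_app_surjective {F G : C ⥤ AddCommGrpCat.{v}} (α : F ⟶ G) (M : C) :
    Function.Surjective ((cokernel.π α).app M) :=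
  (AddCommGrpCat.epi_iff_surjective _).1 inferInstance

theorem cokernel_app_exact {F G : C ⥤ AddCommGrpCat.{v}} (α : F ⟶ G) (M : C) :
    Function.Exact (α.app M) ((cokernel.π α).app M) := by
  have h := (ShortComplex.exact_cokernel α).map ((evaluation C AddCommGrpCat.{v}).obj M)
  exact (ShortComplex.ab_exact_iff_function_exact _).1 h

theorem kernel_app_injective {F G : C ⥤ AddCommGrpCat.{v}} (α : F ⟶ G) (M : C) :
    Function.Injective ((kernel.ι α).app M) :=
  (AddCommGrpCat.mono_iff_injective _).1 inferInstance

theorem kernel_app_exact {F G : C ⥤ AddCommGrpCat.{v}} (α : F ⟶ G) (M : C) :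
    Function.Exact ((kernel.ι α).app M) (α.app M) := by
  have h := (ShortComplex.exact_kernel α).map ((evaluation C AddCommGrpCat.{v}).obj M)
  exact (ShortComplex.ab_exact_iff_function_exact _).1 h

variable [Preadditive C]

/-- The covariant representable functor `Hom(X, -)` with values in abelian groups. -/
abbrev homFunctor (X : C) : C ⥤ AddCommGrpCat.{v} := preadditiveCoyoneda.obj (op X)

/-- The natural transformation `Hom(f, -) : Hom(Y, -) ⟶ Hom(X, -)` given by `f : X ⟶ Y`. -/
abbrev homFunctorMap {X Y : C} (f : X ⟶ Y) : homFunctor Y ⟶ homFunctor X :=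
  preadditiveCoyoneda.map f.op

/-- A functor `F` is finitely presented if there is a sequence
`Hom(Y, -) ⟶ Hom(X, -) ⟶ F ⟶ 0` which is exact when evaluated at any object. -/
def IsFinitelyPresentedFunctor : ObjectProperty (C ⥤ AddCommGrpCat.{v}) := fun F =>
  ∃ (X Y : C) (η : homFunctor Y ⟶ homFunctor X) (π : homFunctor X ⟶ F),
    ∀ M : C, Function.Exact (η.app M) (π.app M) ∧ Function.Surjective (π.app M)

/-- The value at `g : X ⟶ M` of a natural transformation `Hom(X, -) ⟶ F`. -/
def ev {X : C} {F : C ⥤ AddCommGrpCat.{v}} (π : homFunctor X ⟶ F) {M : C} (g : X ⟶ M) :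
    F.obj M := (π.app M).hom g

theorem ev_comp {X : C} {F : C ⥤ AddCommGrpCat.{v}} (π : homFunctor X ⟶ F) {M N : C}
    (g : X ⟶ M) (h : M ⟶ N) : ev π (g ≫ h) = F.map h (ev π g) :=
  congr($(π.naturality h) g)

theorem ev_sub {X : C} {F : C ⥤ AddCommGrpCat.{v}} (π : homFunctor X ⟶ F) {M : C}
    (g h : X ⟶ M) : ev π (g - h) = ev π g - ev π h :=
  map_sub (π.app M).hom g h

theorem ev_add {X : C} {F : C ⥤ AddCommGrpCat.{v}} (π : homFunctor X ⟶ F) {M : C}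
    (g h : X ⟶ M) : ev π (g + h) = ev π g + ev π h :=
  map_add (π.app M).hom g h

theorem ev_trans {X : C} {F G : C ⥤ AddCommGrpCat.{v}} (π : homFunctor X ⟶ F) (α : F ⟶ G)
    {M : C} (g : X ⟶ M) : ev (π ≫ α) g = α.app M (ev π g) := rfl

theorem ev_homFunctorMap {X Y : C} {F : C ⥤ AddCommGrpCat.{v}} (f : X ⟶ Y)
    (π : homFunctor X ⟶ F) {M : C} (g : Y ⟶ M) : ev (homFunctorMap f ≫ π) g = ev π (f ≫ g) := rfl

theorem homFunctorMap_comp {X Y Z : C} (f : X ⟶ Y) (g : Y ⟶ Z) :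
    homFunctorMap (f ≫ g) = homFunctorMap g ≫ homFunctorMap f := by
  rw [homFunctorMap, op_comp, Functor.map_comp]

theorem ev_ext {X : C} {F : C ⥤ AddCommGrpCat.{v}} {π π' : homFunctor X ⟶ F}
    (h : ev π (𝟙 X) = ev π' (𝟙 X)) : π = π' := by
  ext M g
  change X ⟶ M at g
  have := ev_comp π (𝟙 X) g
  have h2 := ev_comp π' (𝟙 X) g
  rw [Category.id_comp] at this h2
  exact this.trans ((congrArg _ h).trans h2.symm)

/-- A projective presentation `Hom(Y, -) ⟶ Hom(X, -) ⟶ F ⟶ 0` of `F` induced by a morphism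
`f : X ⟶ Y`. -/
structure ProjPres (F : C ⥤ AddCommGrpCat.{v}) where
  {X Y : C}
  f : X ⟶ Y
  π : homFunctor X ⟶ F
  exact : ∀ (M : C) (g : X ⟶ M), ev π g = 0 ↔ ∃ h : Y ⟶ M, f ≫ h = g
  surj : ∀ (M : C) (x : F.obj M), ∃ g : X ⟶ M, ev π g = x

theorem ProjPres.isFinitelyPresentedFunctor {F : C ⥤ AddCommGrpCat.{v}} (P : ProjPres F) :
    IsFinitelyPresentedFunctor F :=
  ⟨P.X, P.Y, homFunctorMap P.f, P.π, fun M => ⟨fun g => P.exact M g, fun x => P.surj M x⟩⟩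

theorem IsFinitelyPresentedFunctor.nonempty_projPres {F : C ⥤ AddCommGrpCat.{v}}
    (hF : IsFinitelyPresentedFunctor F) : Nonempty (ProjPres F) := by
  obtain ⟨X, Y, η, π, h⟩ := hF
  obtain ⟨f, rfl⟩ := preadditiveCoyoneda.map_surjective η
  exact ⟨⟨f.unop, π, fun M g => (h M).1 g, fun M x => (h M).2 x⟩⟩

/-- Any natural transformation lifts to projective presentations. -/
theorem ProjPres.exists_lift {F G : C ⥤ AddCommGrpCat.{v}} (P : ProjPres F) (Q : ProjPres G)
    (α : F ⟶ G) : ∃ φ : Q.X ⟶ P.X, homFunctorMap φ ≫ Q.π = P.π ≫ α := by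
  obtain ⟨φ, hφ⟩ := Q.surj P.X (ev (P.π ≫ α) (𝟙 _))
  exact ⟨φ, ev_ext (by rw [ev_homFunctorMap, Category.comp_id, hφ])⟩

theorem ProjPres.f_π {F : C ⥤ AddCommGrpCat.{v}} (P : ProjPres F) :
    homFunctorMap P.f ≫ P.π = 0 :=
  ev_ext (by rw [ev_homFunctorMap]; exact (P.exact _ _).2 ⟨_, rfl⟩)

/-- Such a lift is compatible with the morphisms inducing the presentations. -/
theorem ProjPres.exists_lift' {F G : C ⥤ AddCommGrpCat.{v}} (P : ProjPres F) (Q : ProjPres G)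
    {α : F ⟶ G} {φ : Q.X ⟶ P.X} (h : homFunctorMap φ ≫ Q.π = P.π ≫ α) :
    ∃ ψ : Q.Y ⟶ P.Y, Q.f ≫ ψ = φ ≫ P.f := by
  refine (Q.exact _ _).1 ?_
  have h1 : ev (homFunctorMap φ ≫ Q.π) P.f = ev (P.π ≫ α) P.f := by rw [h]
  rw [ev_homFunctorMap, ev_trans, (P.exact _ P.f).2 ⟨𝟙 _, Category.comp_id _⟩] at h1
  rw [h1, map_zero]

/-- Two lifts of the same natural transformation differ by a morphism through `Q.f`. -/
theorem ProjPres.lift_unique {F G : C ⥤ AddCommGrpCat.{v}} (P : ProjPres F) (Q : ProjPres G)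
    {φ φ' : Q.X ⟶ P.X} (h : homFunctorMap φ ≫ Q.π = homFunctorMap φ' ≫ Q.π) :
    ∃ s : Q.Y ⟶ P.X, Q.f ≫ s = φ - φ' := by
  refine (Q.exact _ _).1 ?_
  have h1 : ev (homFunctorMap φ ≫ Q.π) (𝟙 _) = ev (homFunctorMap φ' ≫ Q.π) (𝟙 _) := by rw [h]
  rw [ev_homFunctorMap, ev_homFunctorMap, Category.comp_id, Category.comp_id] at h1
  rw [ev_sub, h1, sub_self]

/-- The functor `Coker(Hom(f, -) : Hom(Y, -) ⟶ Hom(X, -))` with its tautological presentation. -/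
def cokerPres {X Y : C} (f : X ⟶ Y) : ProjPres (cokernel (homFunctorMap f)) where
  f := f
  π := cokernel.π _
  exact M g := cokernel_app_exact (homFunctorMap f) M g
  surj M x := cokernel_app_surjective (homFunctorMap f) M x

/-- If weak pushouts exist, the kernel of a morphism of finitely presented functors is again
finitely presented. -/
theorem kernel_isFinitelyPresentedFunctor
    (hC : ∀ {W X Y : C} (a : W ⟶ X) (b : W ⟶ Y), ∃ (Z : C) (i : X ⟶ Z) (j : Y ⟶ Z),
      a ≫ i = b ≫ j ∧ ∀ {M : C} (g : X ⟶ M) (h : Y ⟶ M), a ≫ g = b ≫ h →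
        ∃ z : Z ⟶ M, i ≫ z = g ∧ j ≫ z = h)
    {F G : C ⥤ AddCommGrpCat.{v}} (hF : IsFinitelyPresentedFunctor F)
    (hG : IsFinitelyPresentedFunctor G) (α : F ⟶ G) :
    IsFinitelyPresentedFunctor (kernel α) := by
  obtain ⟨P⟩ := hF.nonempty_projPres
  obtain ⟨Q⟩ := hG.nonempty_projPres
  obtain ⟨φ, hφ⟩ := P.exists_lift Q α
  obtain ⟨Z, i, j, hij, hZ⟩ := hC φ Q.f
  obtain ⟨W, k, l, hkl, hW⟩ := hC P.f i
  have h0 : (homFunctorMap i ≫ P.π) ≫ α = 0 := ev_ext (by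
    rw [Category.assoc, ← hφ, ev_homFunctorMap, ev_homFunctorMap, Category.comp_id, hij]
    exact (Q.exact _ _).2 ⟨_, rfl⟩)
  have key : ∀ {M : C} (z : Z ⟶ M),
      (kernel.ι α).app M (ev (kernel.lift α _ h0) z) = ev P.π (i ≫ z) := fun z => by
    rw [← ev_trans, kernel.lift_ι, ev_homFunctorMap]
  refine ProjPres.isFinitelyPresentedFunctor ⟨l, kernel.lift α _ h0, fun M z => ?_, fun M x => ?_⟩
  · rw [← (injective_iff_map_eq_zero' _).1 (kernel_app_injective α M), key, P.exact]
    constructor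
    · rintro ⟨y, hy⟩
      obtain ⟨w, -, hw⟩ := hW y z hy
      exact ⟨w, hw⟩
    · rintro ⟨w, rfl⟩
      exact ⟨k ≫ w, by rw [← Category.assoc, hkl, Category.assoc]⟩
  · obtain ⟨g, hg⟩ := P.surj M ((kernel.ι α).app M x)
    have h1 : ev Q.π (φ ≫ g) = 0 := by
      rw [← ev_homFunctorMap, hφ, ev_trans, hg]
      exact (kernel_app_exact α M _).2 ⟨x, rfl⟩
    obtain ⟨y, hy⟩ := (Q.exact _ _).1 h1
    obtain ⟨z, hz, -⟩ := hZ g y hy.symm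
    exact ⟨z, kernel_app_injective α M (by rw [key, hz, hg])⟩

/-- Replacing the morphism of a projective presentation by an isomorphic one. -/
def ProjPres.ofIso {F : C ⥤ AddCommGrpCat.{v}}
    (P : ProjPres F) {X Y : C} (f : X ⟶ Y) (e₁ : X ≅ P.X) (e₂ : Y ≅ P.Y)
    (h : f ≫ e₂.hom = e₁.hom ≫ P.f) : ProjPres F where
  f := f
  π := homFunctorMap e₁.inv ≫ P.π
  exact M g := by
    rw [ev_homFunctorMap, P.exact]
    constructor
    · rintro ⟨y, hy⟩
      refine ⟨e₂.hom ≫ y, ?_⟩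
      rw [← Category.assoc, h, Category.assoc, hy, e₁.hom_inv_id_assoc]
    · rintro ⟨y, rfl⟩
      refine ⟨e₂.inv ≫ y, ?_⟩
      have h' : e₁.inv ≫ f = P.f ≫ e₂.inv := by
        rw [Iso.inv_comp_eq, ← Category.assoc, ← h, Category.assoc, e₂.hom_inv_id,
          Category.comp_id]
      rw [← Category.assoc, ← h', Category.assoc]
  surj M x := by
    obtain ⟨g, hg⟩ := P.surj M x
    exact ⟨e₁.hom ≫ g, by rw [ev_homFunctorMap, e₁.inv_hom_id_assoc, hg]⟩

theorem ProjPres.isIso_desc  {F : C ⥤ AddCommGrpCat.{v}} (P : ProjPres F) :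
    IsIso (cokernel.desc (homFunctorMap P.f) P.π P.f_π) := by
  have key : ∀ (M : C) (g : P.X ⟶ M), (cokernel.desc (homFunctorMap P.f) P.π P.f_π).app M
      (ev (cokernel.π (homFunctorMap P.f)) g) = ev P.π g := fun M g => by
    rw [← ev_trans, cokernel.π_desc]
  refine (NatTrans.isIso_iff_isIso_app _).2 fun M => ?_
  rw [ConcreteCategory.isIso_iff_bijective]
  constructor
  · refine (injective_iff_map_eq_zero _).2 fun x hx => ?_
    obtain ⟨g, rfl⟩ := (cokerPres P.f).surj M x
    exact ((cokerPres P.f).exact M g).2 ((P.exact M g).1 ((key M g).symm.trans hx))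
  · intro x
    obtain ⟨g, rfl⟩ := P.surj M x
    exact ⟨_, key M g⟩

end FinitelyPresentedFunctors

section Adelman

/-- Three term chains `X₁ ⟶ X₂ ⟶ X₃` in a category (not necessarily complexes). -/
structure Chain (C : Type u) [Category.{v} C] where
  {X₁ X₂ X₃ : C}
  f₁ : X₁ ⟶ X₂
  f₂ : X₂ ⟶ X₃

variable {C : Type u} [Category.{v} C]

/-- Morphisms of three term chains: commutative diagrams `(α₁, α₂, α₃)`. -/
@[ext]
structure Chain.Hom (X Y : Chain C) where
  α₁ : X.X₁ ⟶ Y.X₁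
  α₂ : X.X₂ ⟶ Y.X₂
  α₃ : X.X₃ ⟶ Y.X₃
  comm₁ : X.f₁ ≫ α₂ = α₁ ≫ Y.f₁
  comm₂ : X.f₂ ≫ α₃ = α₂ ≫ Y.f₂

instance : Category (Chain C) where
  Hom := Chain.Hom
  id X := ⟨𝟙 _, 𝟙 _, 𝟙 _, by simp, by simp⟩
  comp α β := ⟨α.α₁ ≫ β.α₁, α.α₂ ≫ β.α₂, α.α₃ ≫ β.α₃,
    by rw [← Category.assoc, α.comm₁, Category.assoc, β.comm₁, Category.assoc],
    by rw [← Category.assoc, α.comm₂, Category.assoc, β.comm₂, Category.assoc]⟩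

@[simp] theorem Chain.id_α₂ (X : Chain C) : Chain.Hom.α₂ (𝟙 X) = 𝟙 X.X₂ := rfl

@[simp] theorem Chain.comp_α₂ {X Y Z : Chain C} (α : X ⟶ Y) (β : Y ⟶ Z) :
    Chain.Hom.α₂ (α ≫ β) = α.α₂ ≫ β.α₂ := rfl

variable [Preadditive C]

/-- Two chain morphisms are identified if their difference is null-homotopic, that is, if the
middle component of the difference is of the form `g₁ s + t f₂`. -/
def chainHomotopic : HomRel (Chain C) := fun X Y α β =>
  ∃ (s : X.X₂ ⟶ Y.X₁) (t : X.X₃ ⟶ Y.X₂), α.α₂ - β.α₂ = s ≫ Y.f₁ + X.f₂ ≫ t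

instance : Congruence (chainHomotopic (C := C)) where
  equivalence :=
    { refl := fun α => ⟨0, 0, by simp⟩
      symm := by
        rintro α β ⟨s, t, h⟩
        exact ⟨-s, -t, by rw [← neg_sub, h, Preadditive.neg_comp, Preadditive.comp_neg, neg_add]⟩
      trans := by
        rintro α β γ ⟨s, t, h⟩ ⟨s', t', h'⟩
        refine ⟨s + s', t + t', ?_⟩
        rw [← sub_add_sub_cancel, h, h', Preadditive.add_comp, Preadditive.comp_add]
        abel }
  comp_left := by
    rintro X Y Z α β β' ⟨s, t, h⟩
    refine ⟨α.α₂ ≫ s, α.α₃ ≫ t, ?_⟩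
    rw [Chain.comp_α₂, Chain.comp_α₂, ← Preadditive.comp_sub, h, Preadditive.comp_add,
      Category.assoc, ← Category.assoc X.f₂, α.comm₂, Category.assoc]
  comp_right := by
    rintro X Y Z α β γ ⟨s, t, h⟩
    refine ⟨s ≫ γ.α₁, t ≫ γ.α₂, ?_⟩
    rw [Chain.comp_α₂, Chain.comp_α₂, ← Preadditive.sub_comp, h, Preadditive.add_comp,
      Category.assoc, Category.assoc, γ.comm₁, Category.assoc]

variable (C) in
/-- Adelman's category: three term chains with chain morphisms modulo null-homotopic ones. -/
abbrev Adelman := CategoryTheory.Quotient (chainHomotopic (C := C))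

end Adelman

section Matrices

/-- The additive category with objects `A⁰, A¹, A², …`; the object `Aⁿ` is encoded by `n`. -/
structure FreeCat (A : Type u) where
  n : ℕ

variable (A : Type u) [Ring A]

/-- A morphism `Aⁿ ⟶ Aᵐ` is an `m × n` matrix, and composition is matrix multiplication. -/
instance : Category (FreeCat A) where
  Hom X Y := Matrix (Fin Y.n) (Fin X.n) A
  id X := (1 : Matrix (Fin X.n) (Fin X.n) A)
  comp {X Y Z} (U : Matrix (Fin Y.n) (Fin X.n) A) (V : Matrix (Fin Z.n) (Fin Y.n) A) := V * U
  id_comp U := Matrix.mul_one U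
  comp_id U := Matrix.one_mul U
  assoc U V W := (Matrix.mul_assoc W V U).symm

instance : Preadditive (FreeCat A) where
  homGroup X Y := inferInstanceAs (AddCommGroup (Matrix (Fin Y.n) (Fin X.n) A))
  add_comp _ _ _ U U' V := Matrix.mul_add V U U'
  comp_add _ _ _ U V V' := Matrix.add_mul V V' U

variable {A}

/-- The matrix of a morphism of `FreeCat A`. -/
def FreeCat.mat {X Y : FreeCat A} (U : X ⟶ Y) : Matrix (Fin Y.n) (Fin X.n) A := U

/-- The matrix `U` over `A`, acting on row vectors by right multiplication, is the transposed
matrix with entries in `Aᵐᵒᵖ`, acting on column vectors by left multiplication. -/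
def FreeCat.dual {X Y : FreeCat A} (U : X ⟶ Y) :
    (⟨Y.n⟩ : FreeCat Aᵐᵒᵖ) ⟶ ⟨X.n⟩ :=
  ((FreeCat.mat U).transpose.map MulOpposite.op : Matrix (Fin X.n) (Fin Y.n) Aᵐᵒᵖ)

theorem FreeCat.dual_id (X : FreeCat A) : FreeCat.dual (𝟙 X) = 𝟙 (⟨X.n⟩ : FreeCat Aᵐᵒᵖ) := by
  change ((1 : Matrix (Fin X.n) (Fin X.n) A).transpose.map MulOpposite.op) = 1
  rw [Matrix.transpose_one, Matrix.map_one _ rfl rfl]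

theorem FreeCat.dual_comp {X Y Z : FreeCat A} (U : X ⟶ Y) (V : Y ⟶ Z) :
    FreeCat.dual (U ≫ V) = FreeCat.dual V ≫ FreeCat.dual U := by
  change (FreeCat.mat V * FreeCat.mat U).transpose.map MulOpposite.op =
    (FreeCat.mat U).transpose.map MulOpposite.op * (FreeCat.mat V).transpose.map MulOpposite.op
  ext i j
  simp [Matrix.mul_apply]

theorem FreeCat.dual_add {X Y : FreeCat A} (U V : X ⟶ Y) :
    FreeCat.dual (U + V) = FreeCat.dual U + FreeCat.dual V := rfl

theorem FreeCat.dual_sub {X Y : FreeCat A} (U V : X ⟶ Y) :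
    FreeCat.dual (U - V) = FreeCat.dual U - FreeCat.dual V := rfl

/-- The contravariant functor on chains of matrices that reverses all arrows and replaces left
multiplication on columns by right multiplication on rows. -/
def chainDual (A : Type u) [Ring A] : (Chain (FreeCat A))ᵒᵖ ⥤ Chain (FreeCat Aᵐᵒᵖ) where
  obj X := ⟨FreeCat.dual X.unop.f₂, FreeCat.dual X.unop.f₁⟩
  map α :=
    { α₁ := FreeCat.dual α.unop.α₃
      α₂ := FreeCat.dual α.unop.α₂
      α₃ := FreeCat.dual α.unop.α₁
      comm₁ := by rw [← FreeCat.dual_comp, ← FreeCat.dual_comp, α.unop.comm₂]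
      comm₂ := by rw [← FreeCat.dual_comp, ← FreeCat.dual_comp, α.unop.comm₁] }
  map_id X := Chain.Hom.ext (FreeCat.dual_id _) (FreeCat.dual_id _) (FreeCat.dual_id _)
  map_comp α β :=
    Chain.Hom.ext (FreeCat.dual_comp _ _) (FreeCat.dual_comp _ _) (FreeCat.dual_comp _ _)

/-- The duality on Adelman's category induced by `chainDual`. -/
def dIII (A : Type u) [Ring A] : (Adelman (FreeCat A))ᵒᵖ ⥤ Adelman (FreeCat Aᵐᵒᵖ) :=
  (CategoryTheory.Quotient.lift _ (chainDual A ⋙ CategoryTheory.Quotient.functor _).rightOp (by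
    rintro X Y α β ⟨s, t, h⟩
    refine congrArg Quiver.Hom.op (CategoryTheory.Quotient.sound _
      ⟨FreeCat.dual t, FreeCat.dual s, ?_⟩)
    change FreeCat.dual α.α₂ - FreeCat.dual β.α₂ =
      FreeCat.dual t ≫ FreeCat.dual X.f₂ + FreeCat.dual Y.f₁ ≫ FreeCat.dual s
    rw [← FreeCat.dual_sub, h, FreeCat.dual_add, FreeCat.dual_comp, FreeCat.dual_comp,
      add_comm])).leftOp

end Matrices

section Modules

variable (A : Type u) [Ring A]

/-- The category `mod-A` of finitely presented right `A`-modules; right `A`-modules are modules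
over `Aᵐᵒᵖ`. -/
abbrev FPMod := ObjectProperty.FullSubcategory
  (fun M : ModuleCat.{u} Aᵐᵒᵖ => Module.FinitePresentation Aᵐᵒᵖ M)

/-- The category `mod-(mod-A)` of finitely presented functors `mod-A ⥤ Ab`. -/
abbrev FPFun := (IsFinitelyPresentedFunctor (C := FPMod A)).FullSubcategory

variable {A}

instance (X : FPMod A) : Module.FinitePresentation Aᵐᵒᵖ X.obj := X.property

/-- Bundle a finitely presented right module. -/
abbrev FPMod.of (M : Type u) [AddCommGroup M] [Module Aᵐᵒᵖ M] [Module.FinitePresentation Aᵐᵒᵖ M] :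
    FPMod A := ⟨ModuleCat.of Aᵐᵒᵖ M, inferInstance⟩

/-- Bundle a linear map. -/
abbrev FPMod.ofHom {X Y : FPMod A} (f : X.obj →ₗ[Aᵐᵒᵖ] Y.obj) : X ⟶ Y :=
  ObjectProperty.homMk (ModuleCat.ofHom f)

/-- The linear map underlying a morphism of `FPMod A`. -/
abbrev FPMod.lin {X Y : FPMod A} (f : X ⟶ Y) : X.obj →ₗ[Aᵐᵒᵖ] Y.obj := f.hom.hom

theorem FPMod.hom_ext {X Y : FPMod A} {f g : X ⟶ Y} (h : FPMod.lin f = FPMod.lin g) : f = g :=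
  ObjectProperty.hom_ext _ (ModuleCat.hom_ext h)

theorem FPMod.hom_ext' {X Y : FPMod A} {f g : X ⟶ Y}
    (h : ∀ x, FPMod.lin f x = FPMod.lin g x) : f = g :=
  FPMod.hom_ext (LinearMap.ext h)

theorem FPMod.lin_comp {X Y Z : FPMod A} (f : X ⟶ Y) (g : Y ⟶ Z) :
    FPMod.lin (f ≫ g) = FPMod.lin g ∘ₗ FPMod.lin f := rfl

/-- `Aⁿ` as a right module is isomorphic to `(Aᵐᵒᵖ)ⁿ`. -/
def opEquiv (n : ℕ) : (Fin n → A) ≃ₗ[Aᵐᵒᵖ] (Fin n → Aᵐᵒᵖ) where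
  toFun x i := MulOpposite.op (x i)
  invFun x i := MulOpposite.unop (x i)
  map_add' _ _ := rfl
  map_smul' _ _ := rfl
  left_inv _ := rfl
  right_inv _ := rfl

instance (n : ℕ) : Module.FinitePresentation Aᵐᵒᵖ (Fin n → A) :=
  Module.FinitePresentation.of_equiv (opEquiv n).symm

instance (n : ℕ) : Module.Projective Aᵐᵒᵖ (Fin n → A) :=
  Module.Projective.of_equiv (opEquiv n).symm

/-- The homomorphism `Aⁿ → Aᵐ` of right modules given by an `m × n` matrix acting from the left
on column vectors. -/
def colMap {X Y : FreeCat A} (U : X ⟶ Y) : (Fin X.n → A) →ₗ[Aᵐᵒᵖ] (Fin Y.n → A) :=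
  Matrix.mulVecBilin A Aᵐᵒᵖ (FreeCat.mat U)

theorem colMap_id (X : FreeCat A) : colMap (𝟙 X) = LinearMap.id :=
  LinearMap.ext fun x => Matrix.one_mulVec x

theorem colMap_comp {X Y Z : FreeCat A} (U : X ⟶ Y) (V : Y ⟶ Z) :
    colMap (U ≫ V) = colMap V ∘ₗ colMap U :=
  LinearMap.ext fun x => (Matrix.mulVec_mulVec x (FreeCat.mat V) (FreeCat.mat U)).symm

theorem colMap_add {X Y : FreeCat A} (U V : X ⟶ Y) : colMap (U + V) = colMap U + colMap V :=
  LinearMap.ext fun x => Matrix.add_mulVec (FreeCat.mat U) (FreeCat.mat V) x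

theorem colMap_sub {X Y : FreeCat A} (U V : X ⟶ Y) : colMap (U - V) = colMap U - colMap V :=
  LinearMap.ext fun x => Matrix.sub_mulVec (FreeCat.mat U) (FreeCat.mat V) x

theorem colMap_injective {X Y : FreeCat A} {U V : X ⟶ Y} (h : colMap U = colMap V) : U = V :=
  Matrix.ext_of_mulVec_single fun i => LinearMap.congr_fun h (Pi.single i 1)

theorem colMap_surjective {X Y : FreeCat A} (f : (Fin X.n → A) →ₗ[Aᵐᵒᵖ] (Fin Y.n → A)) :
    ∃ U : X ⟶ Y, colMap U = f := by
  refine ⟨(Matrix.of fun i j => f (Pi.single j 1) i : Matrix (Fin Y.n) (Fin X.n) A), ?_⟩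
  refine LinearMap.ext fun x => ?_
  have hx : x = ∑ j, MulOpposite.op (x j) • (Pi.single j 1 : Fin X.n → A) := by
    ext i
    simp [Finset.sum_apply, Pi.single_apply]
  conv_rhs => rw [hx, map_sum]
  ext i
  simp only [map_smul, Finset.sum_apply, Pi.smul_apply, MulOpposite.smul_eq_mul_unop]
  rfl

/-- The cokernel `Aⁿ / U Aᵐ` of a matrix. -/
def coker {X Y : FreeCat A} (U : X ⟶ Y) : FPMod A :=
  haveI : Module.FinitePresentation Aᵐᵒᵖ ((Fin Y.n → A) ⧸ LinearMap.range (colMap U)) :=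
    Module.finitePresentation_of_surjective (LinearMap.range (colMap U)).mkQ
      (Submodule.mkQ_surjective _) (by rw [Submodule.ker_mkQ]; exact Submodule.fg_range _)
  FPMod.of ((Fin Y.n → A) ⧸ LinearMap.range (colMap U))

/-- The projection of `Aⁿ` onto the cokernel. -/
def coker.proj {X Y : FreeCat A} (U : X ⟶ Y) : (Fin Y.n → A) →ₗ[Aᵐᵒᵖ] (coker U).obj :=
  (LinearMap.range (colMap U)).mkQ

theorem coker.proj_surjective {X Y : FreeCat A} (U : X ⟶ Y) :
    Function.Surjective (coker.proj U) := Submodule.mkQ_surjective _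

theorem coker.proj_eq_zero {X Y : FreeCat A} (U : X ⟶ Y) (x : Fin Y.n → A) :
    coker.proj U x = 0 ↔ ∃ y, colMap U y = x :=
  (Submodule.Quotient.mk_eq_zero _).trans Iff.rfl

/-- The morphism of cokernels induced by a commutative square. -/
def coker.map {X Y X' Y' : FreeCat A} (U : X ⟶ Y) (U' : X' ⟶ Y') (a : X ⟶ X') (b : Y ⟶ Y')
    (h : U ≫ b = a ≫ U') : coker U ⟶ coker U' :=
  FPMod.ofHom ((LinearMap.range (colMap U)).mapQ (LinearMap.range (colMap U')) (colMap b) (by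
    rintro _ ⟨y, rfl⟩
    refine ⟨colMap a y, ?_⟩
    rw [← LinearMap.comp_apply, ← LinearMap.comp_apply, ← colMap_comp, ← colMap_comp, h]))

theorem coker.map_proj {X Y X' Y' : FreeCat A} (U : X ⟶ Y) (U' : X' ⟶ Y') (a : X ⟶ X')
    (b : Y ⟶ Y') (h : U ≫ b = a ≫ U') (x : Fin Y.n → A) :
    FPMod.lin (coker.map U U' a b h) (coker.proj U x) = coker.proj U' (colMap b x) := rfl

theorem coker.hom_ext {X Y : FreeCat A} {U : X ⟶ Y} {Z : FPMod A} {f g : coker U ⟶ Z}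
    (h : ∀ x, FPMod.lin f (coker.proj U x) = FPMod.lin g (coker.proj U x)) : f = g :=
  FPMod.hom_ext' fun x => by
    obtain ⟨x, rfl⟩ := coker.proj_surjective U x
    exact h x

/-- Lifting a morphism of cokernels to free modules. -/
theorem coker.exists_lift {X Y X' Y' : FreeCat A} (U : X ⟶ Y) (U' : X' ⟶ Y')
    (φ : coker U ⟶ coker U') :
    ∃ b : Y ⟶ Y', ∀ x, FPMod.lin φ (coker.proj U x) = coker.proj U' (colMap b x) := by
  obtain ⟨b', hb⟩ := Module.projective_lifting_property (coker.proj U')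
      (FPMod.lin φ ∘ₗ coker.proj U) (coker.proj_surjective _)
  obtain ⟨b, rfl⟩ := colMap_surjective b'
  exact ⟨b, fun x => (LinearMap.congr_fun hb x).symm⟩

/-- A matrix whose columns vanish in the cokernel of `U` factors through `U`. -/
theorem coker.exists_factor {X Y Z : FreeCat A} (U : X ⟶ Y) (b : Z ⟶ Y)
    (h : ∀ x, coker.proj U (colMap b x) = 0) : ∃ a : Z ⟶ X, b = a ≫ U := by
  obtain ⟨s', hs'⟩ := Module.projective_lifting_property (LinearMap.rangeRestrict (colMap U))
      ((colMap b).codRestrict (LinearMap.range (colMap U))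
        fun x => (coker.proj_eq_zero _ _).1 (h x)) (LinearMap.surjective_rangeRestrict _)
  obtain ⟨s, rfl⟩ := colMap_surjective s'
  refine ⟨s, colMap_injective (LinearMap.ext fun x => ?_)⟩
  rw [colMap_comp]
  exact (congrArg Subtype.val (LinearMap.congr_fun hs' x)).symm

/-- For a chain `Aᵐ → Aⁿ → Aᵖ` given by `u` and `v`, the morphism `Coker u ⟶ Coker vu` induced
by `v`. -/
def chainMor (X : Chain (FreeCat A)) : coker X.f₁ ⟶ coker (X.f₁ ≫ X.f₂) :=
  coker.map X.f₁ (X.f₁ ≫ X.f₂) (𝟙 _) X.f₂ (by rw [Category.id_comp])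

/-- The morphism on `Coker u` induced by a morphism of chains. -/
def chainMap₁ {X Y : Chain (FreeCat A)} (α : X ⟶ Y) : coker X.f₁ ⟶ coker Y.f₁ :=
  coker.map _ _ α.α₁ α.α₂ α.comm₁

/-- The morphism on `Coker vu` induced by a morphism of chains. -/
def chainMap₂ {X Y : Chain (FreeCat A)} (α : X ⟶ Y) :
    coker (X.f₁ ≫ X.f₂) ⟶ coker (Y.f₁ ≫ Y.f₂) :=
  coker.map _ _ α.α₁ α.α₃ (by
    rw [Category.assoc, α.comm₂, ← Category.assoc, α.comm₁, Category.assoc])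

theorem chainMap_comm {X Y : Chain (FreeCat A)} (α : X ⟶ Y) :
    chainMor X ≫ chainMap₂ α = chainMap₁ α ≫ chainMor Y :=
  coker.hom_ext fun x => congrArg (coker.proj _) (by
    rw [← LinearMap.comp_apply, ← LinearMap.comp_apply, ← colMap_comp, ← colMap_comp, α.comm₂])

/-- The finitely presented functor attached to a chain `Aᵐ → Aⁿ → Aᵖ` given by `u` and `v`: the
cokernel of `Hom(Coker vu, -) ⟶ Hom(Coker u, -)`. -/
abbrev chainFun (X : Chain (FreeCat A)) : FPFun A :=
  ⟨cokernel (homFunctorMap (chainMor X)), (cokerPres (chainMor X)).isFinitelyPresentedFunctor⟩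

/-- The morphism of cokernels induced by a morphism of chains. -/
def chainFunMap {X Y : Chain (FreeCat A)} (α : X ⟶ Y) : chainFun Y ⟶ chainFun X :=
  ObjectProperty.homMk (cokernel.map (homFunctorMap (chainMor Y)) (homFunctorMap (chainMor X))
    (homFunctorMap (chainMap₂ α)) (homFunctorMap (chainMap₁ α)) (by
      rw [← Functor.map_comp, ← Functor.map_comp, ← op_comp, ← op_comp, chainMap_comm]))

theorem chainFunMap_π {X Y : Chain (FreeCat A)} (α : X ⟶ Y) :
    cokernel.π (homFunctorMap (chainMor Y)) ≫ (chainFunMap α).hom =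
      homFunctorMap (chainMap₁ α) ≫ cokernel.π (homFunctorMap (chainMor X)) :=
  cokernel.π_desc _ _ _

/-- Morphisms out of `chainFun` are determined by their composition with the projection. -/
theorem chainFun_hom_ext {X : Chain (FreeCat A)} {F : FPFun A} {a b : chainFun X ⟶ F}
    (h : cokernel.π (homFunctorMap (chainMor X)) ≫ a.hom = cokernel.π (homFunctorMap (chainMor X)) ≫ b.hom) : a = b :=
  ObjectProperty.hom_ext _ (coequalizer.hom_ext h)

theorem chainFunMap_eq_iff {X Y : Chain (FreeCat A)} (α β : X ⟶ Y) :
    chainFunMap α = chainFunMap β ↔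
      ∃ s : coker (X.f₁ ≫ X.f₂) ⟶ coker Y.f₁, chainMor X ≫ s = chainMap₁ α - chainMap₁ β := by
  constructor
  · intro h
    have h1 : homFunctorMap (chainMap₁ α) ≫ cokernel.π (homFunctorMap (chainMor X)) =
        homFunctorMap (chainMap₁ β) ≫ cokernel.π (homFunctorMap (chainMor X)) := by
      rw [← chainFunMap_π, ← chainFunMap_π, h]
    exact (cokerPres (chainMor Y)).lift_unique (cokerPres (chainMor X)) h1
  · rintro ⟨s, hs⟩
    refine chainFun_hom_ext ?_
    rw [chainFunMap_π, chainFunMap_π]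
    refine ev_ext ?_
    rw [ev_homFunctorMap, ev_homFunctorMap, ← sub_eq_zero, ← ev_sub, Category.comp_id,
      Category.comp_id, ← hs]
    exact ((cokerPres (chainMor X)).exact _ _).2 ⟨s, rfl⟩

/-- Chain morphisms induce the same morphism of functors exactly if they are homotopic. -/
theorem chainFunMap_eq_iff_homotopic {X Y : Chain (FreeCat A)} (α β : X ⟶ Y) :
    chainFunMap α = chainFunMap β ↔ chainHomotopic α β := by
  rw [chainFunMap_eq_iff]
  constructor
  · rintro ⟨r, hr⟩
    obtain ⟨t', ht'⟩ := Module.projective_lifting_property (coker.proj Y.f₁)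
      (FPMod.lin r ∘ₗ coker.proj (X.f₁ ≫ X.f₂)) (coker.proj_surjective _)
    obtain ⟨t, rfl⟩ := colMap_surjective t'
    have h1 : ∀ x, coker.proj Y.f₁ ((colMap (α.α₂ - β.α₂ - X.f₂ ≫ t)) x) = 0 := fun x => by
      have h2 : FPMod.lin r (coker.proj (X.f₁ ≫ X.f₂) (colMap X.f₂ x)) =
          coker.proj Y.f₁ (colMap α.α₂ x) - coker.proj Y.f₁ (colMap β.α₂ x) :=
        congr(FPMod.lin $hr (coker.proj X.f₁ x))
      rw [colMap_sub, colMap_sub, colMap_comp, LinearMap.sub_apply, LinearMap.sub_apply, map_sub,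
        map_sub, ← h2, LinearMap.comp_apply, ← LinearMap.comp_apply (coker.proj Y.f₁), ht']
      exact sub_self _
    obtain ⟨s, hs⟩ := coker.exists_factor _ _ h1
    exact ⟨s, t, by rw [← hs, sub_add_cancel]⟩
  · rintro ⟨s, t, h⟩
    have h0 : ∀ y, coker.proj Y.f₁ (colMap t (colMap (X.f₁ ≫ X.f₂) y)) = 0 := fun y => by
      have h3 : X.f₁ ≫ X.f₂ ≫ t = (α.α₁ - β.α₁ - X.f₁ ≫ s) ≫ Y.f₁ := by
        have h4 := congrArg (X.f₁ ≫ ·) h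
        simp only [Preadditive.comp_sub, Preadditive.comp_add, α.comm₁, β.comm₁] at h4
        rw [Preadditive.sub_comp, Preadditive.sub_comp, h4, Category.assoc, add_sub_cancel_left]
      rw [← LinearMap.comp_apply (colMap t), ← colMap_comp, Category.assoc, h3, colMap_comp]
      exact (coker.proj_eq_zero _ _).2 ⟨_, rfl⟩
    refine ⟨FPMod.ofHom ((LinearMap.range (colMap (X.f₁ ≫ X.f₂))).liftQ
      (coker.proj Y.f₁ ∘ₗ colMap t) ?_), coker.hom_ext fun x => ?_⟩
    · rintro _ ⟨y, rfl⟩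
      exact h0 y
    · change coker.proj Y.f₁ (colMap t (colMap X.f₂ x)) =
        coker.proj Y.f₁ (colMap α.α₂ x) - coker.proj Y.f₁ (colMap β.α₂ x)
      rw [← map_sub, ← LinearMap.sub_apply, ← colMap_sub, h, colMap_add, LinearMap.add_apply,
        map_add, colMap_comp, colMap_comp]
      exact ((congrArg (· + _) ((coker.proj_eq_zero _ _).2 ⟨_, rfl⟩)).trans (zero_add _)).symm

/-- The functor on chains given by `chainFun`. -/
def chainFunctor (A : Type u) [Ring A] : Chain (FreeCat A) ⥤ (FPFun A)ᵒᵖ where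
  obj X := op (chainFun X)
  map α := (chainFunMap α).op
  map_id X := congrArg Quiver.Hom.op (chainFun_hom_ext (by
    rw [chainFunMap_π]
    have : chainMap₁ (𝟙 X) = 𝟙 _ := coker.hom_ext fun x => by
      change coker.proj _ (colMap (𝟙 _) x) = _
      rw [colMap_id]; rfl
    rw [this]
    rfl))
  map_comp α β := congrArg Quiver.Hom.op (chainFun_hom_ext (by
    have : chainMap₁ (α ≫ β) = chainMap₁ α ≫ chainMap₁ β := coker.hom_ext fun x => by
      change coker.proj _ (colMap (α.α₂ ≫ β.α₂) x) = _
      rw [colMap_comp]; rfl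
    change _ = _ ≫ (chainFunMap β).hom ≫ (chainFunMap α).hom
    rw [chainFunMap_π, ← Category.assoc, chainFunMap_π,
      Category.assoc, chainFunMap_π, this, homFunctorMap_comp, Category.assoc]))

/-- The functor `𝔨⁻¹` from Adelman's category to `(mod-(mod-A))ᵒᵖ`. -/
def kInv (A : Type u) [Ring A] : Adelman (FreeCat A) ⥤ (FPFun A)ᵒᵖ :=
  CategoryTheory.Quotient.lift _ (chainFunctor A) fun _ _ α β h =>
    congrArg Quiver.Hom.op ((chainFunMap_eq_iff_homotopic α β).2 h)

instance : (kInv A).Faithful where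
  map_injective {X Y} := by
    rintro ⟨α⟩ ⟨β⟩ h
    exact CategoryTheory.Quotient.sound _
      ((chainFunMap_eq_iff_homotopic α β).1 (congrArg Quiver.Hom.unop h))

instance : (kInv A).Full where
  map_surjective {X Y} := by
    intro θ
    obtain ⟨X⟩ := X
    obtain ⟨Y⟩ := Y
    change op (chainFun X) ⟶ op (chainFun Y) at θ
    let P := cokerPres (chainMor X)
    let Q := cokerPres (chainMor Y)
    obtain ⟨φ, hφ⟩ := Q.exists_lift P θ.unop.hom
    obtain ⟨ψ, hψ⟩ := Q.exists_lift' P hφ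
    change coker X.f₁ ⟶ coker Y.f₁ at φ
    change coker (X.f₁ ≫ X.f₂) ⟶ coker (Y.f₁ ≫ Y.f₂) at ψ
    change chainMor X ≫ ψ = φ ≫ chainMor Y at hψ
    obtain ⟨b, hb⟩ := coker.exists_lift _ _ φ
    obtain ⟨c, hc⟩ := coker.exists_lift _ _ ψ
    obtain ⟨w, hw⟩ := coker.exists_factor (Y.f₁ ≫ Y.f₂) (X.f₂ ≫ c - b ≫ Y.f₂) fun x => by
      have h1 : FPMod.lin ψ (coker.proj (X.f₁ ≫ X.f₂) (colMap X.f₂ x)) =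
          FPMod.lin (chainMor Y) (FPMod.lin φ (coker.proj X.f₁ x)) :=
        congr(FPMod.lin $hψ (coker.proj X.f₁ x))
      rw [hb, hc] at h1
      rw [colMap_sub, LinearMap.sub_apply, map_sub, colMap_comp, colMap_comp, LinearMap.comp_apply,
        h1]
      exact sub_self _
    have hb' : ∀ x, FPMod.lin φ (coker.proj X.f₁ x) =
        coker.proj Y.f₁ (colMap (b + w ≫ Y.f₁) x) := fun x => by
      rw [hb, colMap_add, LinearMap.add_apply, map_add, colMap_comp]
      exact ((congrArg (_ + ·) ((coker.proj_eq_zero _ _).2 ⟨_, rfl⟩)).trans (add_zero _)).symm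
    obtain ⟨a, ha⟩ := coker.exists_factor Y.f₁ (X.f₁ ≫ (b + w ≫ Y.f₁)) fun x => by
      rw [colMap_comp, LinearMap.comp_apply, ← hb', (coker.proj_eq_zero _ _).2 ⟨x, rfl⟩, map_zero]
    let α : X ⟶ Y := ⟨a, b + w ≫ Y.f₁, c, ha, by
      rw [Preadditive.add_comp, Category.assoc, ← hw, add_sub_cancel]⟩
    have hα : chainMap₁ α = φ := coker.hom_ext fun x => (hb' x).symm
    refine ⟨(CategoryTheory.Quotient.functor _).map α, Quiver.Hom.unop_inj (chainFun_hom_ext ?_)⟩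
    refine (chainFunMap_π α).trans ?_
    rw [hα]
    exact hφ

/-- A module presented by a matrix is isomorphic to its cokernel. -/
def coker.iso {X Y : FreeCat A} (U : X ⟶ Y) {M : FPMod A} (p : (Fin Y.n → A) →ₗ[Aᵐᵒᵖ] M.obj)
    (hp : Function.Surjective p) (h : LinearMap.range (colMap U) = LinearMap.ker p) :
    coker U ≅ M :=
  ObjectProperty.isoMk _ (LinearEquiv.toModuleIso
    ((Submodule.quotEquivOfEq _ _ h).trans (p.quotKerEquivOfSurjective hp)))

theorem coker.iso_proj {X Y : FreeCat A} (U : X ⟶ Y) {M : FPMod A}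
    (p : (Fin Y.n → A) →ₗ[Aᵐᵒᵖ] M.obj)
    (hp : Function.Surjective p) (h : LinearMap.range (colMap U) = LinearMap.ker p)
    (x : Fin Y.n → A) : FPMod.lin (coker.iso U p hp h).hom (coker.proj U x) = p x := rfl

theorem exists_matrix_of_fg {Y : FreeCat A} (K : Submodule Aᵐᵒᵖ (Fin Y.n → A)) (hK : K.FG) :
    ∃ (X : FreeCat A) (U : X ⟶ Y), LinearMap.range (colMap U) = K := by
  obtain ⟨m, g, hg⟩ := K.fg_iff_exists_fin_linearMap.mp hK
  obtain ⟨U, hU⟩ := colMap_surjective (X := ⟨m⟩) (Y := Y) (g ∘ₗ (opEquiv m).toLinearMap)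
  refine ⟨⟨m⟩, U, ?_⟩
  rw [hU, LinearMap.range_comp_of_range_eq_top _ (LinearEquiv.range _), hg]

theorem FPMod.exists_pres (M : FPMod A) :
    ∃ (X Y : FreeCat A) (U : X ⟶ Y) (p : (Fin Y.n → A) →ₗ[Aᵐᵒᵖ] M.obj),
      Function.Surjective p ∧ LinearMap.range (colMap U) = LinearMap.ker p := by
  obtain ⟨n, m, f, g, hf, -⟩ := Module.FinitePresentation.exists_fin' Aᵐᵒᵖ M.obj
  let p := f ∘ₗ (opEquiv n).toLinearMap
  have hp : Function.Surjective p := hf.comp (opEquiv n).surjective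
  obtain ⟨X, U, hU⟩ := exists_matrix_of_fg (Y := ⟨n⟩) (LinearMap.ker p)
    (Module.FinitePresentation.fg_ker p hp)
  exact ⟨X, ⟨n⟩, U, p, hp, hU⟩

instance : (kInv A).EssSurj where
  mem_essImage F := by
    obtain ⟨P⟩ := F.unop.property.nonempty_projPres
    obtain ⟨-, N, -, p, hp, -⟩ := P.X.exists_pres
    obtain ⟨K, L, D, q, hq, hD⟩ := P.Y.exists_pres
    obtain ⟨c, hc⟩ := Module.projective_lifting_property q (FPMod.lin P.f ∘ₗ p) hq
    let a : (Fin (N.n + K.n) → A) →ₗ[Aᵐᵒᵖ] (Fin N.n → A) :=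
      LinearMap.funLeft Aᵐᵒᵖ A (Fin.castAdd K.n)
    let b : (Fin (N.n + K.n) → A) →ₗ[Aᵐᵒᵖ] (Fin K.n → A) :=
      LinearMap.funLeft Aᵐᵒᵖ A (Fin.natAdd N.n)
    have hab : ∀ x y, ∃ z, a z = x ∧ b z = y := fun x y =>
      ⟨Fin.append x y, funext fun i => Fin.append_left x y i,
        funext fun i => Fin.append_right x y i⟩
    have hpa : Function.Surjective (p ∘ₗ a) :=
      hp.comp fun x => (hab x 0).imp fun _ h => h.1
    obtain ⟨M, U, hU⟩ := exists_matrix_of_fg (Y := ⟨N.n + K.n⟩) (LinearMap.ker (p ∘ₗ a))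
      (Module.FinitePresentation.fg_ker _ hpa)
    obtain ⟨V, hV⟩ := colMap_surjective (X := ⟨N.n + K.n⟩) (Y := L) (c ∘ₗ a - colMap D ∘ₗ b)
    have hqD : ∀ y, q (colMap D y) = 0 := fun y =>
      LinearMap.mem_ker.1 (hD ▸ LinearMap.mem_range_self _ y)
    have hqc : ∀ x, q (c x) = FPMod.lin P.f (p x) := LinearMap.congr_fun hc
    have hqV : ∀ z, q (colMap V z) = FPMod.lin P.f (p (a z)) := fun z => by
      rw [hV, LinearMap.sub_apply, map_sub, LinearMap.comp_apply, LinearMap.comp_apply, hqD,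
        sub_zero, hqc]
    have hUV : LinearMap.range (colMap (U ≫ V)) = LinearMap.ker q := by
      rw [colMap_comp, LinearMap.range_comp, hU]
      ext y
      constructor
      · rintro ⟨z, hz, rfl⟩
        rw [LinearMap.mem_ker, hqV, show p (a z) = 0 from hz, map_zero]
      · intro hy
        obtain ⟨w, rfl⟩ : y ∈ LinearMap.range (colMap D) := hD ▸ hy
        obtain ⟨z, hz, hz'⟩ := hab 0 (-w)
        refine ⟨z, ?_, ?_⟩
        · change p (a z) = 0
          rw [hz, map_zero]
        · rw [hV, LinearMap.sub_apply, LinearMap.comp_apply, LinearMap.comp_apply, hz, hz',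
            map_zero, map_neg, zero_sub, neg_neg]
    let X : Chain (FreeCat A) := ⟨U, V⟩
    let P' : ProjPres F.unop.obj := P.ofIso (chainMor X) (coker.iso U _ hpa hU)
      (coker.iso (U ≫ V) q hq hUV) (coker.hom_ext fun x => hqV x)
    have := P'.isIso_desc
    exact ⟨⟨X⟩, ⟨(ObjectProperty.isoMk _ (asIso (cokernel.desc _ P'.π P'.f_π)).symm :
      F.unop ≅ chainFun X).op⟩⟩

instance : (kInv A).IsEquivalence where

/-- The equivalence `𝔨 : (mod-(mod-A))ᵒᵖ ⥤ III(𝔸)`, the quasi-inverse of `𝔨⁻¹`. -/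
def k (A : Type u) [Ring A] : (FPFun A)ᵒᵖ ⥤ Adelman (FreeCat A) := (kInv A).inv

instance : (k A).IsEquivalence := inferInstanceAs (kInv A).inv.IsEquivalence

end Modules

section Tensor

open TensorProduct

variable {A : Type u} [Ring A]

/-- The subgroup of `X ⊗_ℤ N` generated by the elements `xa ⊗ n - x ⊗ an`, for a right
`A`-module `X` and a left `A`-module `N` (a right module over `Aᵐᵒᵖ`). -/
def balanced (X : Type u) [AddCommGroup X] [Module Aᵐᵒᵖ X]
    (N : Type u) [AddCommGroup N] [Module Aᵐᵒᵖᵐᵒᵖ N] : Submodule ℤ (X ⊗[ℤ] N) :=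
  Submodule.span ℤ {t | ∃ (x : X) (a : A) (n : N),
    t = (MulOpposite.op a • x) ⊗ₜ[ℤ] n - x ⊗ₜ[ℤ] (MulOpposite.op (MulOpposite.op a) • n)}

/-- The tensor product `X ⊗_A N`, an abelian group. -/
abbrev Ten (X : FPMod A) (N : FPMod Aᵐᵒᵖ) : Type u :=
  (X.obj ⊗[ℤ] N.obj) ⧸ balanced (A := A) X.obj N.obj

/-- The element `x ⊗ n` of `X ⊗_A N`. -/
def Ten.tmul {X : FPMod A} {N : FPMod Aᵐᵒᵖ} (x : X.obj) (n : N.obj) : Ten X N :=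
  Submodule.Quotient.mk (x ⊗ₜ[ℤ] n)

theorem Ten.add_tmul {X : FPMod A} {N : FPMod Aᵐᵒᵖ} (x y : X.obj) (n : N.obj) :
    Ten.tmul (x + y) n = Ten.tmul x n + Ten.tmul y n :=
  congrArg Submodule.Quotient.mk (TensorProduct.add_tmul x y n)

theorem Ten.tmul_add {X : FPMod A} {N : FPMod Aᵐᵒᵖ} (x : X.obj) (n m : N.obj) :
    Ten.tmul x (n + m) = Ten.tmul x n + Ten.tmul x m :=
  congrArg Submodule.Quotient.mk (TensorProduct.tmul_add x n m)

theorem Ten.zero_tmul {X : FPMod A} {N : FPMod Aᵐᵒᵖ} (n : N.obj) :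
    Ten.tmul (0 : X.obj) n = 0 :=
  congrArg Submodule.Quotient.mk (TensorProduct.zero_tmul X.obj n)

theorem Ten.sum_tmul {X : FPMod A} {N : FPMod Aᵐᵒᵖ} {ι : Type} (s : Finset ι) (x : ι → X.obj)
    (n : N.obj) : Ten.tmul (∑ i ∈ s, x i) n = ∑ i ∈ s, Ten.tmul (x i) n :=
  map_sum (AddMonoidHom.mk' (fun x : X.obj => Ten.tmul x n) fun x y => Ten.add_tmul x y n) x s

theorem Ten.tmul_sum {X : FPMod A} {N : FPMod Aᵐᵒᵖ} {ι : Type} (s : Finset ι) (x : X.obj)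
    (n : ι → N.obj) : Ten.tmul x (∑ i ∈ s, n i) = ∑ i ∈ s, Ten.tmul x (n i) :=
  map_sum (AddMonoidHom.mk' (fun n : N.obj => Ten.tmul x n) fun m n => Ten.tmul_add x m n) n s

theorem Ten.smul_tmul {X : FPMod A} {N : FPMod Aᵐᵒᵖ} (a : A) (x : X.obj) (n : N.obj) :
    Ten.tmul (MulOpposite.op a • x) n =
      Ten.tmul x (MulOpposite.op (MulOpposite.op a) • n) :=
  (Submodule.Quotient.eq _).2 (Submodule.subset_span ⟨x, a, n, rfl⟩)

theorem Ten.hom_ext {X : FPMod A} {N : FPMod Aᵐᵒᵖ} {G : Type u} [AddCommGroup G]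
    {f g : Ten X N →+ G} (h : ∀ x n, f (Ten.tmul x n) = g (Ten.tmul x n)) : f = g := by
  ext t
  obtain ⟨t, rfl⟩ := Submodule.Quotient.mk_surjective _ t
  induction t with
  | zero => rw [Submodule.Quotient.mk_zero, map_zero, map_zero]
  | add x y hx hy => rw [Submodule.Quotient.mk_add, map_add, map_add, hx, hy]
  | tmul x n => exact h x n

/-- The homomorphism out of `X ⊗_A N` given by a balanced biadditive map. -/
def Ten.lift {X : FPMod A} {N : FPMod Aᵐᵒᵖ} {G : Type u} [AddCommGroup G]
    (b : X.obj →+ N.obj →+ G)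
    (hb : ∀ x (a : A) n, b (MulOpposite.op a • x) n =
      b x (MulOpposite.op (MulOpposite.op a) • n)) : Ten X N →+ G :=
  ((balanced (A := A) X.obj N.obj).liftQ (TensorProduct.liftAddHom b
    (fun r x n => by rw [map_zsmul, map_zsmul]; rfl)).toIntLinearMap (by
      refine Submodule.span_le.2 ?_
      rintro _ ⟨x, a, n, rfl⟩
      rw [SetLike.mem_coe, LinearMap.mem_ker, map_sub]
      exact sub_eq_zero.2 (hb x a n))).toAddMonoidHom

theorem Ten.lift_tmul {X : FPMod A} {N : FPMod Aᵐᵒᵖ} {G : Type u} [AddCommGroup G]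
    (b : X.obj →+ N.obj →+ G) (hb) (x : X.obj) (n : N.obj) :
    Ten.lift b hb (Ten.tmul x n) = b x n := rfl

/-- The homomorphism `f ⊗ g : X ⊗_A N → Y ⊗_A M`. -/
def Ten.map {X Y : FPMod A} {N M : FPMod Aᵐᵒᵖ} (f : X ⟶ Y) (g : N ⟶ M) : Ten X N →+ Ten Y M :=
  Ten.lift
    (AddMonoidHom.mk' (fun x => AddMonoidHom.mk' (fun n => Ten.tmul (FPMod.lin f x) (FPMod.lin g n))
        fun n m => (congrArg (Ten.tmul (FPMod.lin f x)) (map_add (FPMod.lin g) n m)).trans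
          (Ten.tmul_add _ _ _))
      fun x y => AddMonoidHom.ext fun n =>
        (congrArg (fun z => Ten.tmul z (FPMod.lin g n)) (map_add (FPMod.lin f) x y)).trans
          (Ten.add_tmul _ _ _))
    fun x a n => by
      change Ten.tmul (FPMod.lin f (MulOpposite.op a • x)) (FPMod.lin g n) =
        Ten.tmul (FPMod.lin f x) (FPMod.lin g (MulOpposite.op (MulOpposite.op a) • n))
      rw [map_smul, map_smul, Ten.smul_tmul]

theorem Ten.map_tmul {X Y : FPMod A} {N M : FPMod Aᵐᵒᵖ} (f : X ⟶ Y) (g : N ⟶ M) (x : X.obj)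
    (n : N.obj) : Ten.map f g (Ten.tmul x n) = Ten.tmul (FPMod.lin f x) (FPMod.lin g n) := rfl

variable (A) in
/-- The functor sending `X` to the functor `X ⊗_A -` on finitely presented left `A`-modules. -/
def tensorFunctor : FPMod A ⥤ FPMod Aᵐᵒᵖ ⥤ AddCommGrpCat.{u} where
  obj X :=
    { obj := fun N => AddCommGrpCat.of (Ten X N)
      map := fun g => AddCommGrpCat.ofHom (Ten.map (𝟙 X) g)
      map_id := fun _ => AddCommGrpCat.hom_ext (Ten.hom_ext fun _ _ => rfl)
      map_comp := fun _ _ => AddCommGrpCat.hom_ext (Ten.hom_ext fun _ _ => rfl) }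
  map f :=
    { app := fun N => AddCommGrpCat.ofHom (Ten.map f (𝟙 N))
      naturality := fun _ _ _ => AddCommGrpCat.hom_ext (Ten.hom_ext fun _ _ => rfl) }
  map_id _ := NatTrans.ext (funext fun _ => AddCommGrpCat.hom_ext (Ten.hom_ext fun _ _ => rfl))
  map_comp _ _ := NatTrans.ext (funext fun _ => AddCommGrpCat.hom_ext (Ten.hom_ext fun _ _ => rfl))

instance : (tensorFunctor A).Additive where
  map_add {_ _ f g} := NatTrans.ext (funext fun _ => AddCommGrpCat.hom_ext
    (Ten.hom_ext fun x n => Ten.add_tmul (FPMod.lin f x) (FPMod.lin g x) n))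

/-- The homomorphism `(Aᵐᵒᵖ)ⁿ → N` that sends the basis vectors to `y₁, …, yₙ`. -/
def ofVec {n : ℕ} {N : FPMod Aᵐᵒᵖ} (y : Fin n → N.obj) :
    (Fin n → Aᵐᵒᵖ) →ₗ[Aᵐᵒᵖᵐᵒᵖ] N.obj where
  toFun z := ∑ i, MulOpposite.op (z i) • y i
  map_add' z w := by simp [add_smul, Finset.sum_add_distrib]
  map_smul' a z := by
    simp only [Finset.smul_sum, smul_smul, RingHom.id_apply]
    rfl

theorem ofVec_single {n : ℕ} {N : FPMod Aᵐᵒᵖ} (y : Fin n → N.obj) (i : Fin n) :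
    ofVec y (Pi.single i 1) = y i := by
  change ∑ j, MulOpposite.op ((Pi.single i 1 : Fin n → Aᵐᵒᵖ) j) • y j = y i
  rw [Finset.sum_eq_single i]
  · rw [Pi.single_eq_same, MulOpposite.op_one, one_smul]
  · intro j _ h
    rw [Pi.single_eq_of_ne h, MulOpposite.op_zero, zero_smul]
  · exact fun h => absurd (Finset.mem_univ i) h

theorem ofVec_self {n : ℕ} {N : FPMod Aᵐᵒᵖ} (h : (Fin n → Aᵐᵒᵖ) →ₗ[Aᵐᵒᵖᵐᵒᵖ] N.obj) :
    ofVec (fun i => h (Pi.single i 1)) = h := by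
  refine LinearMap.ext fun z => ?_
  have hz : z = ∑ j, MulOpposite.op (z j) • (Pi.single j 1 : Fin n → Aᵐᵒᵖ) := by
    ext i
    simp [Finset.sum_apply, Pi.single_apply]
  conv_rhs => rw [hz, map_sum]
  simp only [map_smul]
  rfl

/-- For a finitely presented right module `X`, the functor `X ⊗_A -` is finitely presented. -/
theorem tensor_isFinitelyPresentedFunctor (X : FPMod A) :
    IsFinitelyPresentedFunctor ((tensorFunctor A).obj X) := by
  obtain ⟨M, L, U, p, hp, hU⟩ := X.exists_pres
  let R : FPMod Aᵐᵒᵖ := FPMod.of (Fin L.n → Aᵐᵒᵖ)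
  let S : FPMod Aᵐᵒᵖ := FPMod.of (Fin M.n → Aᵐᵒᵖ)
  let f : R ⟶ S := FPMod.ofHom (colMap (FreeCat.dual U))
  let e : Fin L.n → X.obj := fun i => p (Pi.single i 1)
  let π : homFunctor R ⟶ (tensorFunctor A).obj X :=
    { app := fun N => AddCommGrpCat.ofHom (AddMonoidHom.mk'
        (fun h : R ⟶ N => (∑ i, Ten.tmul (e i) (FPMod.lin h (Pi.single i 1)) : Ten X N))
        fun h h' => by
          rw [← Finset.sum_add_distrib]
          exact Finset.sum_congr rfl fun i _ => Ten.tmul_add _ _ _)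
      naturality := fun N N' g => by
        refine AddCommGrpCat.hom_ext (AddMonoidHom.ext fun h => ?_)
        exact (map_sum (Ten.map (𝟙 X) g)
          (fun i => Ten.tmul (e i) (FPMod.lin (show R ⟶ N from h) (Pi.single i 1)))
          Finset.univ).symm }
  have hπ : ∀ {N : FPMod Aᵐᵒᵖ} (h : R ⟶ N), ev π h =
    (∑ i, Ten.tmul (e i) (FPMod.lin h (Pi.single i 1)) : Ten X N) := fun h => rfl
  have hpe : ∀ c, p c = ∑ i, MulOpposite.op (c i) • e i := fun c => by
    have hc : c = ∑ j, MulOpposite.op (c j) • (Pi.single j 1 : Fin L.n → A) := by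
      ext i
      simp [Finset.sum_apply, Pi.single_apply]
    conv_lhs => rw [hc, map_sum]
    simp only [map_smul]
    rfl
  have hf : ∀ i j, colMap (FreeCat.dual U) (Pi.single i 1) j = MulOpposite.op (FreeCat.mat U i j) :=
    fun i j => congrFun (Matrix.mulVec_single_one (FreeCat.mat (FreeCat.dual U)) i) j
  have hUj : ∀ i j, colMap U (Pi.single j 1) i = FreeCat.mat U i j :=
    fun i j => congrFun (Matrix.mulVec_single_one (FreeCat.mat U) j) i
  refine ProjPres.isFinitelyPresentedFunctor ⟨f, π, fun N h => ⟨fun h0 => ?_, ?_⟩, fun N x => ?_⟩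
  · -- the map `Nᵐ → Nⁿ` given by `U`
    let u : (Fin M.n → N.obj) →+ (Fin L.n → N.obj) := AddMonoidHom.mk'
      (fun y i => ∑ j, MulOpposite.op (MulOpposite.op (FreeCat.mat U i j)) • y j)
      fun y y' => funext fun i => by simp [Finset.sum_add_distrib]
    let Q := (Fin L.n → N.obj) ⧸ u.range
    let b : (Fin L.n → A) →+ N.obj →+ Q := AddMonoidHom.mk'
      (fun c => AddMonoidHom.mk'
        (fun y => QuotientAddGroup.mk fun i => MulOpposite.op (MulOpposite.op (c i)) • y)
        fun y y' => by
          rw [← QuotientAddGroup.mk_add]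
          exact congrArg _ (funext fun i => smul_add _ _ _))
      fun c c' => AddMonoidHom.ext fun y => congrArg QuotientAddGroup.mk
        (funext fun i => add_smul (MulOpposite.op (MulOpposite.op (c i)))
          (MulOpposite.op (MulOpposite.op (c' i))) y)
    have hb : p.toAddMonoidHom.ker ≤ b.ker := fun c hc => by
      obtain ⟨w, rfl⟩ : c ∈ LinearMap.range (colMap U) := by rw [hU]; exact hc
      refine AddMonoidHom.ext fun y => (QuotientAddGroup.eq_zero_iff _).2
        ⟨fun j => MulOpposite.op (MulOpposite.op (w j)) • y, funext fun i => ?_⟩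
      have h5 : colMap U w i = ∑ j, FreeCat.mat U i j * w j := rfl
      rw [h5]
      change ∑ j, MulOpposite.op (MulOpposite.op (FreeCat.mat U i j)) •
        MulOpposite.op (MulOpposite.op (w j)) • y = _
      simp only [smul_smul, Finset.op_sum, Finset.sum_smul]
      rfl
    let b' : X.obj →+ N.obj →+ Q := p.toAddMonoidHom.liftOfSurjective hp ⟨b, hb⟩
    have hb' : ∀ c, b' (p c) = b c := fun c =>
      AddMonoidHom.liftOfRightInverse_comp_apply p.toAddMonoidHom _ _ ⟨b, hb⟩ c
    let Θ : Ten X N →+ Q := Ten.lift b' fun x a n => by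
      obtain ⟨c, rfl⟩ := hp x
      rw [← map_smul, hb', hb']
      refine congrArg QuotientAddGroup.mk (funext fun i => ?_)
      rw [smul_smul]
      rfl
    have h1 : Θ (ev π h) = QuotientAddGroup.mk fun i => FPMod.lin h (Pi.single i 1) := by
      rw [hπ, map_sum]
      have h2 : ∀ i, Θ (Ten.tmul (e i) (FPMod.lin h (Pi.single i 1))) =
          QuotientAddGroup.mk (Pi.single i (FPMod.lin h (Pi.single i 1))) := fun i => by
        rw [Ten.lift_tmul, hb']
        refine congrArg QuotientAddGroup.mk (funext fun i' => ?_)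
        by_cases hi : i' = i
        · subst hi
          rw [Pi.single_eq_same, Pi.single_eq_same, MulOpposite.op_one, MulOpposite.op_one,
            one_smul]
        · rw [Pi.single_eq_of_ne hi, Pi.single_eq_of_ne hi, MulOpposite.op_zero,
            MulOpposite.op_zero, zero_smul]
      rw [Finset.sum_congr rfl fun i _ => h2 i]
      refine (map_sum (QuotientAddGroup.mk' u.range) _ _).symm.trans (congrArg _ ?_)
      exact Finset.univ_sum_single _
    obtain ⟨y, hy⟩ := (QuotientAddGroup.eq_zero_iff _).1
      (h1.symm.trans ((congrArg Θ h0).trans (map_zero Θ)))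
    refine ⟨FPMod.ofHom (ofVec y), FPMod.hom_ext ?_⟩
    refine Eq.trans ?_ (ofVec_self (FPMod.lin h))
    refine Eq.trans (ofVec_self _).symm (congrArg ofVec (funext fun i => ?_))
    refine Eq.trans ?_ (congrFun hy i)
    change ∑ j, MulOpposite.op (colMap (FreeCat.dual U) (Pi.single i 1) j) • y j =
      ∑ j, MulOpposite.op (MulOpposite.op (FreeCat.mat U i j)) • y j
    simp only [hf]
  · rintro ⟨g, rfl⟩
    have h3 : ∀ i, FPMod.lin (f ≫ g) (Pi.single i 1) =
        ∑ j, MulOpposite.op (MulOpposite.op (FreeCat.mat U i j)) •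
          FPMod.lin g (Pi.single j 1) := fun i => by
      change FPMod.lin g (colMap (FreeCat.dual U) (Pi.single i 1)) = _
      conv_lhs => rw [← ofVec_self (FPMod.lin g)]
      change ∑ j, MulOpposite.op (colMap (FreeCat.dual U) (Pi.single i 1) j) • _ = _
      simp only [hf]
    rw [hπ]
    simp only [h3, Ten.tmul_sum, ← Ten.smul_tmul]
    rw [Finset.sum_comm]
    refine Finset.sum_eq_zero fun j _ => ?_
    rw [← Ten.sum_tmul]
    have h4 : ∑ i, MulOpposite.op (FreeCat.mat U i j) • e i = 0 := by
      simp only [← hUj]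
      rw [← hpe]
      exact LinearMap.mem_ker.1 (hU ▸ LinearMap.mem_range_self _ _)
    rw [h4, Ten.zero_tmul]
    rfl
  · obtain ⟨x, rfl⟩ := Submodule.Quotient.mk_surjective _ x
    induction x with
    | zero => exact ⟨0, map_zero (π.app N).hom⟩
    | add x y hx hy =>
      obtain ⟨g, hg⟩ := hx
      obtain ⟨g', hg'⟩ := hy
      exact ⟨g + g', by rw [ev_add, hg, hg']; rfl⟩
    | tmul x n =>
      obtain ⟨c, rfl⟩ := hp x
      refine ⟨FPMod.ofHom (ofVec fun i => MulOpposite.op (MulOpposite.op (c i)) • n), ?_⟩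
      rw [hπ]
      change ∑ i, Ten.tmul (e i) (ofVec _ _) = Ten.tmul (p c) n
      simp only [ofVec_single]
      rw [hpe, Ten.sum_tmul]
      simp only [Ten.smul_tmul]

/-- Pushouts of finitely presented modules. -/
theorem FPMod.exists_pushout {W X Y : FPMod A} (a : W ⟶ X) (b : W ⟶ Y) :
    ∃ (Z : FPMod A) (i : X ⟶ Z) (j : Y ⟶ Z),
      a ≫ i = b ≫ j ∧ ∀ {M : FPMod A} (g : X ⟶ M) (h : Y ⟶ M), a ≫ g = b ≫ h →
        ∃ z : Z ⟶ M, i ≫ z = g ∧ j ≫ z = h := by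
  let K := LinearMap.range ((FPMod.lin a).prod (-FPMod.lin b))
  have : Module.FinitePresentation Aᵐᵒᵖ ((X.obj × Y.obj) ⧸ K) :=
    Module.finitePresentation_of_surjective K.mkQ (Submodule.mkQ_surjective _)
      (by rw [Submodule.ker_mkQ]; exact Submodule.fg_range _)
  refine ⟨FPMod.of ((X.obj × Y.obj) ⧸ K), FPMod.ofHom (K.mkQ ∘ₗ LinearMap.inl _ _ _),
    FPMod.ofHom (K.mkQ ∘ₗ LinearMap.inr _ _ _), FPMod.hom_ext' fun w => ?_, fun g h hgh => ?_⟩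
  · refine (Submodule.Quotient.eq K).2 ⟨w, ?_⟩
    ext <;> simp <;> rfl
  · refine ⟨FPMod.ofHom (K.liftQ ((FPMod.lin g).coprod (FPMod.lin h)) ?_),
      FPMod.hom_ext' fun x => ?_, FPMod.hom_ext' fun y => ?_⟩
    · rintro _ ⟨w, rfl⟩
      have h1 : FPMod.lin g (FPMod.lin a w) = FPMod.lin h (FPMod.lin b w) :=
        congr(FPMod.lin $hgh w)
      simp [h1]
    · change FPMod.lin g x + FPMod.lin h 0 = _
      rw [map_zero, add_zero]
    · change FPMod.lin g 0 + FPMod.lin h y = _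
      rw [map_zero, zero_add]

/-- The functor `Ker(X ⊗_A - ⟶ Y ⊗_A -)` for a morphism `f : X ⟶ Y` of `mod-A`. The kernel is
computed in the category of all functors; as it is finitely presented, it is also the kernel in
the full subcategory of finitely presented functors. -/
abbrev kerTensor {X Y : FPMod A} (f : X ⟶ Y) : FPFun Aᵐᵒᵖ :=
  ⟨kernel ((tensorFunctor A).map f), kernel_isFinitelyPresentedFunctor FPMod.exists_pushout
    (tensor_isFinitelyPresentedFunctor X) (tensor_isFinitelyPresentedFunctor Y) _⟩

/-- The morphism `Ker(f ⊗_A -) ⟶ Ker(f' ⊗_A -)` given by a commutative square, through the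
universal property of the kernel. -/
def kerTensorMap {X Y X' Y' : FPMod A} (f : X ⟶ Y) (f' : X' ⟶ Y') (φ : X ⟶ X') (ψ : Y ⟶ Y')
    (h : f ≫ ψ = φ ≫ f') : kerTensor f ⟶ kerTensor f' :=
  ObjectProperty.homMk (kernel.map _ _ ((tensorFunctor A).map φ) ((tensorFunctor A).map ψ)
    (by rw [← Functor.map_comp, ← Functor.map_comp, h]))

theorem kerTensorMap_ι {X Y X' Y' : FPMod A} (f : X ⟶ Y) (f' : X' ⟶ Y') (φ : X ⟶ X')
    (ψ : Y ⟶ Y') (h : f ≫ ψ = φ ≫ f') :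
    (kerTensorMap f f' φ ψ h).hom ≫ kernel.ι ((tensorFunctor A).map f') =
      kernel.ι ((tensorFunctor A).map f) ≫ (tensorFunctor A).map φ :=
  kernel.lift_ι _ _ _

theorem kerTensor_hom_ext {X Y : FPMod A} {f : X ⟶ Y} {F : FPFun Aᵐᵒᵖ} {a b : F ⟶ kerTensor f}
    (h : a.hom ≫ kernel.ι ((tensorFunctor A).map f) =
      b.hom ≫ kernel.ι ((tensorFunctor A).map f)) : a = b :=
  ObjectProperty.hom_ext _ (equalizer.hom_ext h)

/-- A fixed projective presentation of a finitely presented functor. -/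
def pres (F : FPFun A) : ProjPres F.obj := F.property.nonempty_projPres.some

/-- The action on objects of the Auslander–Gruson–Jensen duality:
if `Hom(Y, -) ⟶ Hom(X, -) ⟶ F ⟶ 0` is the presentation of `F` induced by `f : X ⟶ Y`,
then `dF = Ker(X ⊗_A - ⟶ Y ⊗_A -)`. -/
abbrev dObj (F : FPFun A) : FPFun Aᵐᵒᵖ := kerTensor (pres F).f

/-- A lift `Hom(φ, -)` of `α : F ⟶ G` to the presentations. -/
def liftφ {F G : FPFun A} (α : F ⟶ G) : (pres G).X ⟶ (pres F).X :=
  ((pres F).exists_lift (pres G) α.hom).choose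

theorem liftφ_spec {F G : FPFun A} (α : F ⟶ G) :
    homFunctorMap (liftφ α) ≫ (pres G).π = (pres F).π ≫ α.hom :=
  ((pres F).exists_lift (pres G) α.hom).choose_spec

/-- The second component of the lift of `α : F ⟶ G` to the presentations. -/
def liftψ {F G : FPFun A} (α : F ⟶ G) : (pres G).Y ⟶ (pres F).Y :=
  ((pres F).exists_lift' (pres G) (liftφ_spec α)).choose

theorem liftψ_spec {F G : FPFun A} (α : F ⟶ G) :
    (pres G).f ≫ liftψ α = liftφ α ≫ (pres F).f :=
  ((pres F).exists_lift' (pres G) (liftφ_spec α)).choose_spec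

/-- The action on morphisms of the Auslander–Gruson–Jensen duality: `α` is lifted to the
presentations, and the lift induces a morphism of the kernels. -/
def dMap {F G : FPFun A} (α : F ⟶ G) : dObj G ⟶ dObj F :=
  kerTensorMap _ _ (liftφ α) (liftψ α) (liftψ_spec α)

/-- `dMap` does not depend on the lift. -/
theorem dMap_ι {F G : FPFun A} (α : F ⟶ G) (φ : (pres G).X ⟶ (pres F).X)
    (hφ : homFunctorMap φ ≫ (pres G).π = (pres F).π ≫ α.hom) :
    (dMap α).hom ≫ kernel.ι ((tensorFunctor A).map (pres F).f) =
      kernel.ι ((tensorFunctor A).map (pres G).f) ≫ (tensorFunctor A).map φ := by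
  refine (kerTensorMap_ι _ _ _ _ _).trans ?_
  obtain ⟨s, hs⟩ := (pres F).lift_unique (pres G) ((liftφ_spec α).trans hφ.symm)
  rw [← sub_eq_zero, ← Preadditive.comp_sub, ← Functor.map_sub, ← hs, Functor.map_comp,
    kernel.condition_assoc, zero_comp]

/-- The Auslander–Gruson–Jensen duality `d`, a contravariant functor from `mod-(mod-A)` to
`mod-(mod-Aᵒᵖ)`. -/
def d (A : Type u) [Ring A] : (FPFun A)ᵒᵖ ⥤ FPFun Aᵐᵒᵖ where
  obj F := dObj F.unop
  map α := dMap α.unop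
  map_id F := kerTensor_hom_ext (by
    refine (dMap_ι _ (𝟙 _) ?_).trans ?_
    · exact (congrArg (· ≫ _) (preadditiveCoyoneda.map_id _)).trans
        ((Category.id_comp _).trans (Category.comp_id _).symm)
    · exact (congrArg (_ ≫ ·) ((tensorFunctor A).map_id _)).trans
        ((Category.comp_id _).trans (Category.id_comp _).symm))
  map_comp {F G H} α β := kerTensor_hom_ext (by
    refine (dMap_ι _ (liftφ α.unop ≫ liftφ β.unop) ?_).trans ?_
    · change _ = _ ≫ β.unop.hom ≫ α.unop.hom
      rw [homFunctorMap_comp, Category.assoc, liftφ_spec, ← Category.assoc, liftφ_spec,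
        Category.assoc]
    · change _ = ((dMap α.unop).hom ≫ (dMap β.unop).hom) ≫ _
      refine Eq.trans ?_ (Category.assoc _ _ _).symm
      refine Eq.trans ?_ (congrArg (_ ≫ ·) (dMap_ι β.unop _ (liftφ_spec _))).symm
      refine Eq.trans ?_ (Category.assoc _ _ _)
      refine Eq.trans ?_ (congrArg (· ≫ _) (dMap_ι α.unop _ (liftφ_spec _))).symm
      rw [Functor.map_comp, Category.assoc])

end Tensor

end AGJ

end

/-!
For a chain `u : Aᵐ → Aⁿ`, `v : Aⁿ → Aᵖ`, the element `∑ eᵢ ⊗ eᵢ` turns a homomorphism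
`h : Coker vᵗ → N` of left modules into the element `∑ ēᵢ ⊗ h(ēᵢ)` of `Coker u ⊗ N`, which dies in
`Coker vu ⊗ N`. Because `⊗` is right exact, `Coker u ⊗ N` is the cokernel of precomposition with
`uᵗ` on homomorphisms from free modules to `N`, and this yields an exact sequence
`Hom(Coker uᵗvᵗ, -) → Hom(Coker vᵗ, -) → Ker(Coker u ⊗ - → Coker vu ⊗ -) → 0`. Its first map
defines the functor of the dual chain, and its third term is `d` of the functor of the chain.
Hence `d ∘ k⁻¹ ≅ k⁻¹ ∘ d_III`, and it remains to invert the equivalences.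
-/

noncomputable section

namespace AGJ

section Presentations

universe v₁ u₁

variable {C : Type u} [Category.{v} C] [Preadditive C] {F G H : C ⥤ AddCommGrpCat.{v}}

/-- The identification of `F` with the cokernel of the natural transformation presenting it. -/
def ProjPres.cokernelIso (P : ProjPres F) : cokernel (homFunctorMap P.f) ≅ F :=
  haveI := P.isIso_desc
  asIso (cokernel.desc (homFunctorMap P.f) P.π P.f_π)

theorem ProjPres.π_cokernelIso_hom (P : ProjPres F) :
    cokernel.π (homFunctorMap P.f) ≫ P.cokernelIso.hom = P.π :=
  cokernel.π_desc _ _ _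

variable {D : Type u₁} [Category.{v₁} D] [Preadditive D] [HasKernels D] (T : C ⥤ D) [T.Additive]

theorem kernel_ι_comp_map_eq {X Y Z : C} {f : X ⟶ Y} {φ φ' : X ⟶ Z}
    (h : ∃ s : Y ⟶ Z, f ≫ s = φ - φ') :
    kernel.ι (T.map f) ≫ T.map φ = kernel.ι (T.map f) ≫ T.map φ' := by
  obtain ⟨s, hs⟩ := h
  rw [← sub_eq_zero, ← Preadditive.comp_sub, ← Functor.map_sub, ← hs, Functor.map_comp,
    kernel.condition_assoc, zero_comp]

/-- The morphism `Ker(T Q.f) ⟶ Ker(T P.f)` induced by a lift of `α : F ⟶ G` to the presentations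
`P` of `F` and `Q` of `G`. For `T` the tensor functor this is the action of the
Auslander–Gruson–Jensen duality on `α`, computed by arbitrary presentations. -/
def ProjPres.kernelMap (P : ProjPres F) (Q : ProjPres G) (α : F ⟶ G) :
    kernel (T.map Q.f) ⟶ kernel (T.map P.f) :=
  let hφ := (P.exists_lift Q α).choose_spec
  let hψ := (P.exists_lift' Q hφ).choose_spec
  kernel.map _ _ (T.map _) (T.map _)
    ((T.map_comp _ _).symm.trans ((congrArg T.map hψ).trans (T.map_comp _ _)))

theorem ProjPres.kernelMap_ι {P : ProjPres F} {Q : ProjPres G} {α : F ⟶ G} {φ : Q.X ⟶ P.X}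
    (hφ : homFunctorMap φ ≫ Q.π = P.π ≫ α) :
    P.kernelMap T Q α ≫ kernel.ι (T.map P.f) = kernel.ι (T.map Q.f) ≫ T.map φ :=
  (kernel.lift_ι _ _ _).trans <| kernel_ι_comp_map_eq T <|
    P.lift_unique Q ((P.exists_lift Q α).choose_spec.trans hφ.symm)

theorem ProjPres.kernelMap_id (P : ProjPres F) : P.kernelMap T P (𝟙 F) = 𝟙 _ := by
  have h : homFunctorMap (𝟙 P.X) ≫ P.π = P.π ≫ 𝟙 F := by
    rw [homFunctorMap, op_id, CategoryTheory.Functor.map_id, Category.id_comp, Category.comp_id]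
  rw [← cancel_mono (kernel.ι _), kernelMap_ι T h, T.map_id, Category.comp_id, Category.id_comp]

theorem ProjPres.kernelMap_comp (P : ProjPres F) (Q : ProjPres G) (R : ProjPres H) (α : F ⟶ G)
    (β : G ⟶ H) : P.kernelMap T R (α ≫ β) = Q.kernelMap T R β ≫ P.kernelMap T Q α := by
  obtain ⟨φ, hφ⟩ := P.exists_lift Q α
  obtain ⟨ψ, hψ⟩ := Q.exists_lift R β
  have h : homFunctorMap (ψ ≫ φ) ≫ R.π = P.π ≫ α ≫ β := by
    rw [homFunctorMap_comp, Category.assoc, hψ, reassoc_of% hφ]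
  rw [← cancel_mono (kernel.ι _), kernelMap_ι T h, Category.assoc, kernelMap_ι T hφ,
    ← Category.assoc, kernelMap_ι T hψ, Category.assoc, T.map_comp]

/-- The independence of `Ker(T P.f)` of the presentation `P` of `F`. -/
def ProjPres.kernelIso (P Q : ProjPres F) : kernel (T.map P.f) ≅ kernel (T.map Q.f) where
  hom := Q.kernelMap T P (𝟙 F)
  inv := P.kernelMap T Q (𝟙 F)
  hom_inv_id := by rw [← kernelMap_comp, Category.comp_id, kernelMap_id]
  inv_hom_id := by rw [← kernelMap_comp, Category.comp_id, kernelMap_id]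

theorem ProjPres.kernelIso_hom_comp_kernelMap (P P' : ProjPres F) (Q Q' : ProjPres G)
    (α : F ⟶ G) :
    (Q.kernelIso T Q').hom ≫ P'.kernelMap T Q' α = P.kernelMap T Q α ≫ (P.kernelIso T P').hom := by
  rw [kernelIso, kernelIso, ← kernelMap_comp, ← kernelMap_comp, Category.comp_id, Category.id_comp]

end Presentations

section Pairing

variable {A : Type u} [Ring A]

theorem freeHom_apply {n : ℕ} {M : Type*} [AddCommGroup M] [Module Aᵐᵒᵖ M]
    (p : (Fin n → A) →ₗ[Aᵐᵒᵖ] M) (c : Fin n → A) :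
    p c = ∑ i, MulOpposite.op (c i) • p (Pi.single i 1) := by
  have hc : c = ∑ i, MulOpposite.op (c i) • (Pi.single i 1 : Fin n → A) := by
    ext i
    simp [Finset.sum_apply, Pi.single_apply]
  conv_lhs => rw [hc]
  simp only [map_sum, map_smul]

theorem freeHom_ext {n : ℕ} {M : Type*} [AddCommGroup M] [Module Aᵐᵒᵖ M]
    {p q : (Fin n → A) →ₗ[Aᵐᵒᵖ] M} (h : ∀ i, p (Pi.single i 1) = q (Pi.single i 1)) : p = q :=
  LinearMap.ext fun c => by
    rw [freeHom_apply p, freeHom_apply q]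
    simp only [h]

variable {M M' : FPMod A} {N N' : FPMod Aᵐᵒᵖ} {n : ℕ} {X Y : FreeCat A}

/-- The homomorphism `q ↦ ∑ p(eᵢ) ⊗ q(eᵢ)` from `Hom((Aᵐᵒᵖ)ⁿ, N)` to `M ⊗_A N` given by a
homomorphism `p : Aⁿ → M`. -/
def pairing (p : (Fin n → A) →ₗ[Aᵐᵒᵖ] M.obj) :
    ((Fin n → Aᵐᵒᵖ) →ₗ[Aᵐᵒᵖᵐᵒᵖ] N.obj) →+ Ten M N :=
  AddMonoidHom.mk' (fun q => ∑ i, Ten.tmul (p (Pi.single i 1)) (q (Pi.single i 1))) fun q q' => by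
    simp only [LinearMap.add_apply, Ten.tmul_add, Finset.sum_add_distrib]

theorem pairing_apply (p : (Fin n → A) →ₗ[Aᵐᵒᵖ] M.obj)
    (q : (Fin n → Aᵐᵒᵖ) →ₗ[Aᵐᵒᵖᵐᵒᵖ] N.obj) :
    pairing p q = ∑ i, Ten.tmul (p (Pi.single i 1)) (q (Pi.single i 1)) := rfl

theorem map_pairing (f : M ⟶ M') (g : N ⟶ N') (p : (Fin n → A) →ₗ[Aᵐᵒᵖ] M.obj)
    (q : (Fin n → Aᵐᵒᵖ) →ₗ[Aᵐᵒᵖᵐᵒᵖ] N.obj) :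
    Ten.map f g (pairing p q) = pairing (FPMod.lin f ∘ₗ p) (FPMod.lin g ∘ₗ q) := by
  rw [pairing_apply, map_sum]
  rfl

theorem zero_pairing (q : (Fin n → Aᵐᵒᵖ) →ₗ[Aᵐᵒᵖᵐᵒᵖ] N.obj) :
    pairing (0 : (Fin n → A) →ₗ[Aᵐᵒᵖ] M.obj) q = 0 := by
  simp only [pairing_apply, LinearMap.zero_apply, Ten.zero_tmul, Finset.sum_const_zero]

/-- The homomorphism `eᵢ ↦ cᵢ y` from `(Aᵐᵒᵖ)ⁿ` to `N`, as a biadditive function of `c : Aⁿ` and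
`y : N`. -/
def rankOne : (Fin n → A) →+ N.obj →+ ((Fin n → Aᵐᵒᵖ) →ₗ[Aᵐᵒᵖᵐᵒᵖ] N.obj) :=
  AddMonoidHom.mk'
    (fun c => AddMonoidHom.mk'
      (fun y => ofVec fun i => MulOpposite.op (MulOpposite.op (c i)) • y)
      fun y y' => freeHom_ext fun i => by simp only [LinearMap.add_apply, ofVec_single, smul_add])
    fun c c' => AddMonoidHom.ext fun y => freeHom_ext fun i => by
      simp [ofVec_single, add_smul]

theorem rankOne_single (c : Fin n → A) (y : N.obj) (i : Fin n) :
    rankOne c y (Pi.single i 1) = MulOpposite.op (MulOpposite.op (c i)) • y :=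
  ofVec_single _ i

theorem rankOne_smul (a : A) (c : Fin n → A) (y : N.obj) :
    rankOne (MulOpposite.op a • c) y = rankOne c (MulOpposite.op (MulOpposite.op a) • y) :=
  freeHom_ext fun i => by
    rw [rankOne_single, rankOne_single, smul_smul]
    rfl

theorem rankOne_colMap (U : X ⟶ Y) (w : Fin X.n → A) (y : N.obj) :
    rankOne (colMap U w) y = rankOne w y ∘ₗ colMap (FreeCat.dual U) :=
  freeHom_ext fun i => by
    have hU : ∀ j, colMap (FreeCat.dual U) (Pi.single i 1) j = MulOpposite.op (FreeCat.mat U i j) :=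
      congrFun (Matrix.mulVec_single_one (FreeCat.mat (FreeCat.dual U)) i)
    have hw : colMap U w i = ∑ j, FreeCat.mat U i j * w j := rfl
    rw [rankOne_single, LinearMap.comp_apply, freeHom_apply (rankOne w y)]
    simp only [rankOne_single, hU, hw, smul_smul, Finset.op_sum, Finset.sum_smul,
      MulOpposite.op_mul]

theorem sum_rankOne_single (q : (Fin n → Aᵐᵒᵖ) →ₗ[Aᵐᵒᵖᵐᵒᵖ] N.obj) :
    ∑ i, rankOne (Pi.single i 1) (q (Pi.single i 1)) = q :=
  freeHom_ext fun j => by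
    simp [LinearMap.sum_apply, rankOne_single, Pi.single_apply, apply_ite MulOpposite.op]

theorem pairing_rankOne (p : (Fin n → A) →ₗ[Aᵐᵒᵖ] M.obj) (c : Fin n → A) (y : N.obj) :
    pairing p (rankOne c y) = Ten.tmul (p c) y := by
  simp only [pairing_apply, rankOne_single, ← Ten.smul_tmul, ← Ten.sum_tmul, ← freeHom_apply]

variable (N) in
/-- Precomposition with the dual of a matrix `U : Aᵐ → Aⁿ`, whose cokernel is
`Coker U ⊗_A N`. -/
def precompDual (U : X ⟶ Y) :
    ((Fin X.n → Aᵐᵒᵖ) →ₗ[Aᵐᵒᵖᵐᵒᵖ] N.obj) →+ ((Fin Y.n → Aᵐᵒᵖ) →ₗ[Aᵐᵒᵖᵐᵒᵖ] N.obj) :=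
  AddMonoidHom.mk' (· ∘ₗ colMap (FreeCat.dual U)) fun _ _ => rfl

theorem pairing_comp_colMap (U : X ⟶ Y) (p : (Fin Y.n → A) →ₗ[Aᵐᵒᵖ] M.obj)
    (q : (Fin X.n → Aᵐᵒᵖ) →ₗ[Aᵐᵒᵖᵐᵒᵖ] N.obj) :
    pairing (p ∘ₗ colMap U) q = pairing p (q ∘ₗ colMap (FreeCat.dual U)) := by
  calc pairing (p ∘ₗ colMap U) q
    _ = ∑ j, pairing p (rankOne (colMap U (Pi.single j 1)) (q (Pi.single j 1))) := by
      simp only [pairing_rankOne]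
      rfl
    _ = pairing p (precompDual N U (∑ j, rankOne (Pi.single j 1) (q (Pi.single j 1)))) := by
      simp only [map_sum, rankOne_colMap]
      rfl
    _ = pairing p (q ∘ₗ colMap (FreeCat.dual U)) := by
      rw [sum_rankOne_single]
      rfl

theorem pairing_surjective {p : (Fin n → A) →ₗ[Aᵐᵒᵖ] M.obj} (hp : Function.Surjective p) :
    Function.Surjective (pairing p : _ →+ Ten M N) := fun t => by
  obtain ⟨t, rfl⟩ := Submodule.Quotient.mk_surjective _ t
  induction t with
  | zero => exact ⟨0, map_zero _⟩
  | add x y hx hy =>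
    obtain ⟨q, hq⟩ := hx
    obtain ⟨q', hq'⟩ := hy
    exact ⟨q + q', by rw [map_add, hq, hq']; rfl⟩
  | tmul x y =>
    obtain ⟨c, rfl⟩ := hp x
    exact ⟨rankOne c y, pairing_rankOne p c y⟩

theorem coker.proj_comp_colMap (U : X ⟶ Y) : coker.proj U ∘ₗ colMap U = 0 :=
  LinearMap.ext fun x => (coker.proj_eq_zero U _).2 ⟨x, rfl⟩

/-- The morphism out of `Coker U` induced by a homomorphism that vanishes on the image of `U`. -/
def coker.desc (U : X ⟶ Y) (p : (Fin Y.n → A) →ₗ[Aᵐᵒᵖ] M.obj) (hp : p ∘ₗ colMap U = 0) :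
    coker U ⟶ M :=
  FPMod.ofHom ((LinearMap.range (colMap U)).liftQ p (LinearMap.range_le_ker_iff.2 hp))

/-- The biadditive map underlying `cokerTenInv`. -/
def cokerLift (U : X ⟶ Y) : (coker U).obj →+ N.obj →+
    ((Fin Y.n → Aᵐᵒᵖ) →ₗ[Aᵐᵒᵖᵐᵒᵖ] N.obj) ⧸ (precompDual N U).range :=
  (coker.proj U).toAddMonoidHom.liftOfSurjective (coker.proj_surjective U)
    ⟨(AddMonoidHom.compHom (QuotientAddGroup.mk' (precompDual N U).range)).comp rankOne,
    fun c hc => by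
      obtain ⟨w, rfl⟩ := (coker.proj_eq_zero U c).1 hc
      exact AddMonoidHom.ext fun y =>
        (QuotientAddGroup.eq_zero_iff _).2 ⟨rankOne w y, (rankOne_colMap U w y).symm⟩⟩

theorem cokerLift_proj (U : X ⟶ Y) (c : Fin Y.n → A) (y : N.obj) :
    cokerLift U (coker.proj U c) y = QuotientAddGroup.mk (rankOne c y) :=
  DFunLike.congr_fun (AddMonoidHom.liftOfRightInverse_comp_apply (coker.proj U).toAddMonoidHom _
    (Function.rightInverse_surjInv (coker.proj_surjective U)) _ c) y

/-- The inverse of the isomorphism `Coker (precompDual N U) ≅ Coker U ⊗_A N` given by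
`pairing (coker.proj U)`. -/
def cokerTenInv (U : X ⟶ Y) :
    Ten (coker U) N →+ ((Fin Y.n → Aᵐᵒᵖ) →ₗ[Aᵐᵒᵖᵐᵒᵖ] N.obj) ⧸ (precompDual N U).range :=
  Ten.lift (cokerLift U) fun x a n => by
    obtain ⟨c, rfl⟩ := coker.proj_surjective U x
    rw [← map_smul, cokerLift_proj, cokerLift_proj, rankOne_smul]

theorem cokerTenInv_pairing (U : X ⟶ Y) (q : (Fin Y.n → Aᵐᵒᵖ) →ₗ[Aᵐᵒᵖᵐᵒᵖ] N.obj) :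
    cokerTenInv U (pairing (coker.proj U) q) = QuotientAddGroup.mk q := by
  have h : ∀ c y, cokerTenInv (N := N) U (Ten.tmul (coker.proj U c) y) =
      QuotientAddGroup.mk' (precompDual N U).range (rankOne c y) := cokerLift_proj U
  simp only [pairing_apply, map_sum, h]
  exact (map_sum (QuotientAddGroup.mk' (precompDual N U).range) _ _).symm.trans
    (congrArg _ (sum_rankOne_single q))

theorem pairing_proj_eq_zero_iff {U : X ⟶ Y} {q : (Fin Y.n → Aᵐᵒᵖ) →ₗ[Aᵐᵒᵖᵐᵒᵖ] N.obj} :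
    pairing (coker.proj U) q = 0 ↔
      ∃ z : (Fin X.n → Aᵐᵒᵖ) →ₗ[Aᵐᵒᵖᵐᵒᵖ] N.obj, z ∘ₗ colMap (FreeCat.dual U) = q := by
  constructor
  · intro hq
    refine (QuotientAddGroup.eq_zero_iff (N := (precompDual N U).range) q).1 ?_
    rw [← cokerTenInv_pairing, hq, map_zero]
  · rintro ⟨z, rfl⟩
    rw [← pairing_comp_colMap, coker.proj_comp_colMap, zero_pairing]

theorem exists_pairing_eq_of_map_chainMor_eq_zero (X : Chain (FreeCat A))
    {t : Ten (coker X.f₁) N} (ht : Ten.map (chainMor X) (𝟙 N) t = 0) :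
    ∃ q : (Fin X.X₂.n → Aᵐᵒᵖ) →ₗ[Aᵐᵒᵖᵐᵒᵖ] N.obj,
      q ∘ₗ colMap (FreeCat.dual X.f₂) = 0 ∧ pairing (coker.proj X.f₁) q = t := by
  obtain ⟨q, rfl⟩ := pairing_surjective (coker.proj_surjective X.f₁) t
  have hq : pairing (coker.proj (X.f₁ ≫ X.f₂)) (q ∘ₗ colMap (FreeCat.dual X.f₂)) = 0 := by
    rw [map_pairing] at ht
    exact (pairing_comp_colMap X.f₂ _ q).symm.trans ht
  obtain ⟨z, hz⟩ := pairing_proj_eq_zero_iff.1 hq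
  refine ⟨q - z ∘ₗ colMap (FreeCat.dual X.f₁), ?_, ?_⟩
  · rw [LinearMap.sub_comp, ← hz, FreeCat.dual_comp, colMap_comp, LinearMap.comp_assoc, sub_self]
  · rw [map_sub, pairing_proj_eq_zero_iff.2 ⟨z, rfl⟩, sub_zero]

end Pairing

section Duality

variable {A : Type u} [Ring A]

theorem dMap_hom {F G : FPFun A} (α : F ⟶ G) :
    (dMap α).hom = (pres F).kernelMap (tensorFunctor A) (pres G) α.hom := by
  rw [← cancel_mono (kernel.ι _), dMap_ι α _ (liftφ_spec α),
    ProjPres.kernelMap_ι _ (liftφ_spec α)]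

/-- The transpose over `Aᵐᵒᵖ` of a chain of matrices: the object part of `chainDual`. -/
abbrev dualChain (X : Chain (FreeCat A)) : Chain (FreeCat Aᵐᵒᵖ) :=
  ⟨FreeCat.dual X.f₂, FreeCat.dual X.f₁⟩

/-- The transpose over `Aᵐᵒᵖ` of a morphism of chains: the morphism part of `chainDual`. -/
abbrev dualChainMap {X Y : Chain (FreeCat A)} (α : X ⟶ Y) : dualChain Y ⟶ dualChain X :=
  (chainDual A).map α.op

/-- For a chain given by `u` and `v`, the natural transformation `Hom(Coker vᵗ, -) ⟶ Coker u ⊗_A -`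
that sends `h` to `∑ ēᵢ ⊗ h(ēᵢ)`. -/
def chainPairing (X : Chain (FreeCat A)) :
    homFunctor (coker (FreeCat.dual X.f₂)) ⟶ (tensorFunctor A).obj (coker X.f₁) where
  app N := AddCommGrpCat.ofHom (AddMonoidHom.mk'
    (fun h : coker (FreeCat.dual X.f₂) ⟶ N =>
      pairing (coker.proj X.f₁) (FPMod.lin h ∘ₗ coker.proj (FreeCat.dual X.f₂)))
    fun h h' => map_add (pairing (coker.proj X.f₁))
      (FPMod.lin h ∘ₗ coker.proj (FreeCat.dual X.f₂))
      (FPMod.lin h' ∘ₗ coker.proj (FreeCat.dual X.f₂)))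
  naturality N N' g := by
    refine AddCommGrpCat.hom_ext (AddMonoidHom.ext fun h => ?_)
    exact (map_pairing (𝟙 _) g (coker.proj X.f₁)
      (FPMod.lin (show coker (FreeCat.dual X.f₂) ⟶ N from h) ∘ₗ
        coker.proj (FreeCat.dual X.f₂))).symm

theorem ev_chainPairing_comp_map (X : Chain (FreeCat A)) {M : FPMod A} (f : coker X.f₁ ⟶ M)
    {N : FPMod Aᵐᵒᵖ} (h : coker (FreeCat.dual X.f₂) ⟶ N) :
    ev (chainPairing X ≫ (tensorFunctor A).map f) h =
      pairing (FPMod.lin f ∘ₗ coker.proj X.f₁)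
        (FPMod.lin h ∘ₗ coker.proj (FreeCat.dual X.f₂)) :=
  map_pairing f (𝟙 N) _ _

theorem chainPairing_comp_map_chainMor (X : Chain (FreeCat A)) :
    chainPairing X ≫ (tensorFunctor A).map (chainMor X) = 0 := by
  refine ev_ext ((ev_chainPairing_comp_map X _ _).trans ?_)
  refine (pairing_comp_colMap X.f₂ (coker.proj (X.f₁ ≫ X.f₂)) _).trans ?_
  rw [LinearMap.comp_assoc, coker.proj_comp_colMap, LinearMap.comp_zero]
  exact map_zero _

theorem chainPairing_naturality {X Y : Chain (FreeCat A)} (α : X ⟶ Y) :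
    homFunctorMap (chainMap₁ (dualChainMap α)) ≫ chainPairing Y =
      chainPairing X ≫ (tensorFunctor A).map (chainMap₁ α) := by
  refine ev_ext (Eq.trans ?_ (ev_chainPairing_comp_map X _ _).symm)
  exact (pairing_comp_colMap α.α₂ (coker.proj Y.f₁) (coker.proj (FreeCat.dual X.f₂))).symm

/-- The corestriction of `chainPairing X` to `Ker(Coker u ⊗_A - ⟶ Coker vu ⊗_A -)`. -/
def chainKerPairing (X : Chain (FreeCat A)) :
    homFunctor (coker (FreeCat.dual X.f₂)) ⟶ kernel ((tensorFunctor A).map (chainMor X)) :=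
  kernel.lift _ (chainPairing X) (chainPairing_comp_map_chainMor X)

theorem chainKerPairing_ι (X : Chain (FreeCat A)) :
    chainKerPairing X ≫ kernel.ι ((tensorFunctor A).map (chainMor X)) = chainPairing X :=
  kernel.lift_ι _ _ _

theorem ι_ev_chainKerPairing (X : Chain (FreeCat A)) {N : FPMod Aᵐᵒᵖ}
    (h : coker (FreeCat.dual X.f₂) ⟶ N) :
    (kernel.ι ((tensorFunctor A).map (chainMor X))).app N (ev (chainKerPairing X) h) =
      pairing (coker.proj X.f₁) (FPMod.lin h ∘ₗ coker.proj (FreeCat.dual X.f₂)) := by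
  rw [← ev_trans, chainKerPairing_ι]
  rfl

theorem ev_chainKerPairing_eq_zero_iff (X : Chain (FreeCat A)) {N : FPMod Aᵐᵒᵖ}
    (h : coker (FreeCat.dual X.f₂) ⟶ N) :
    ev (chainKerPairing X) h = 0 ↔
      ∃ g : coker (FreeCat.dual X.f₂ ≫ FreeCat.dual X.f₁) ⟶ N, chainMor (dualChain X) ≫ g = h := by
  have h_zero : ev (chainKerPairing X) h = 0 ↔
      pairing (coker.proj X.f₁) (FPMod.lin h ∘ₗ coker.proj (FreeCat.dual X.f₂)) = 0 :=
    (map_eq_zero_iff ((kernel.ι ((tensorFunctor A).map (chainMor X))).app N).hom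
      (kernel_app_injective _ N)).symm.trans (Eq.congr_left (ι_ev_chainKerPairing X h))
  rw [h_zero, pairing_proj_eq_zero_iff]
  constructor
  · rintro ⟨z, hz⟩
    refine ⟨coker.desc (FreeCat.dual X.f₂ ≫ FreeCat.dual X.f₁) z ?_,
      coker.hom_ext (LinearMap.congr_fun hz)⟩
    rw [colMap_comp, ← LinearMap.comp_assoc, hz, LinearMap.comp_assoc, coker.proj_comp_colMap,
      LinearMap.comp_zero]
  · rintro ⟨g, rfl⟩
    exact ⟨FPMod.lin g ∘ₗ coker.proj (FreeCat.dual X.f₂ ≫ FreeCat.dual X.f₁), rfl⟩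

theorem exists_ev_chainKerPairing_eq (X : Chain (FreeCat A)) {N : FPMod Aᵐᵒᵖ}
    (x : (kernel ((tensorFunctor A).map (chainMor X))).obj N) :
    ∃ h : coker (FreeCat.dual X.f₂) ⟶ N, ev (chainKerPairing X) h = x := by
  obtain ⟨q, hq, hqx⟩ := exists_pairing_eq_of_map_chainMor_eq_zero X
    ((kernel_app_exact ((tensorFunctor A).map (chainMor X)) N _).2 ⟨x, rfl⟩)
  exact ⟨coker.desc (FreeCat.dual X.f₂) q hq,
    kernel_app_injective _ N ((ι_ev_chainKerPairing X _).trans hqx)⟩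

/-- For a chain given by `u` and `v`, the presentation of `Ker(Coker u ⊗_A - ⟶ Coker vu ⊗_A -)`
by the dual chain. -/
def kerTensorPres (X : Chain (FreeCat A)) :
    ProjPres (kernel ((tensorFunctor A).map (chainMor X))) where
  f := chainMor (dualChain X)
  π := chainKerPairing X
  exact _ h := ev_chainKerPairing_eq_zero_iff X h
  surj _ x := exists_ev_chainKerPairing_eq X x

/-- The action of a morphism of chains on `Ker(Coker u ⊗_A - ⟶ Coker vu ⊗_A -)`, induced by its
action on the functors of the chains. -/
def kerTensorChainMap {X Y : Chain (FreeCat A)} (α : X ⟶ Y) :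
    kernel ((tensorFunctor A).map (chainMor X)) ⟶ kernel ((tensorFunctor A).map (chainMor Y)) :=
  (cokerPres (chainMor Y)).kernelMap (tensorFunctor A) (cokerPres (chainMor X)) (chainFunMap α).hom

theorem kerTensorChainMap_ι {X Y : Chain (FreeCat A)} (α : X ⟶ Y) :
    kerTensorChainMap α ≫ kernel.ι ((tensorFunctor A).map (chainMor Y)) =
      kernel.ι ((tensorFunctor A).map (chainMor X)) ≫ (tensorFunctor A).map (chainMap₁ α) :=
  ProjPres.kernelMap_ι (tensorFunctor A) (chainFunMap_π α).symm

/-- `chainFun (dualChain X)` is the kernel computed from the tautological presentation of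
`chainFun X`. -/
def chainFunDualIsoKernel (X : Chain (FreeCat A)) :
    (chainFun (dualChain X)).obj ≅ kernel ((tensorFunctor A).map (chainMor X)) :=
  (kerTensorPres X).cokernelIso

theorem π_chainFunDualIsoKernel_hom (X : Chain (FreeCat A)) :
    cokernel.π (homFunctorMap (chainMor (dualChain X))) ≫ (chainFunDualIsoKernel X).hom =
      chainKerPairing X :=
  (kerTensorPres X).π_cokernelIso_hom

theorem chainFunDualIsoKernel_naturality {X Y : Chain (FreeCat A)} (α : X ⟶ Y) :
    (chainFunMap (dualChainMap α)).hom ≫ (chainFunDualIsoKernel Y).hom =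
      (chainFunDualIsoKernel X).hom ≫ kerTensorChainMap α := by
  rw [← cancel_epi (cokernel.π (homFunctorMap (chainMor (dualChain X)))),
    ← cancel_mono (kernel.ι ((tensorFunctor A).map (chainMor Y)))]
  calc _
    _ = homFunctorMap (chainMap₁ (dualChainMap α)) ≫ chainPairing Y := by
      rw [← Category.assoc (cokernel.π _), chainFunMap_π, Category.assoc, Category.assoc,
        ← chainKerPairing_ι Y, ← π_chainFunDualIsoKernel_hom Y, Category.assoc]
    _ = chainPairing X ≫ (tensorFunctor A).map (chainMap₁ α) := chainPairing_naturality α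
    _ = _ := by
      rw [← Category.assoc, π_chainFunDualIsoKernel_hom, Category.assoc, kerTensorChainMap_ι,
        ← Category.assoc, chainKerPairing_ι]

/-- The isomorphism between the functor of the dual chain and the dual of the functor of the
chain. -/
def chainFunDualIso (X : Chain (FreeCat A)) : chainFun (dualChain X) ≅ dObj (chainFun X) :=
  ObjectProperty.isoMk _ (chainFunDualIsoKernel X ≪≫
    (cokerPres (chainMor X)).kernelIso (tensorFunctor A) (pres (chainFun X)))

theorem chainFunDualIso_naturality {X Y : Chain (FreeCat A)} (α : X ⟶ Y) :
    chainFunMap (dualChainMap α) ≫ (chainFunDualIso Y).hom =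
      (chainFunDualIso X).hom ≫ dMap (chainFunMap α) := by
  have h_kernelIso := ProjPres.kernelIso_hom_comp_kernelMap (tensorFunctor A)
    (cokerPres (chainMor Y)) (pres (chainFun Y)) (cokerPres (chainMor X)) (pres (chainFun X))
    (chainFunMap α).hom
  refine ObjectProperty.hom_ext _ ?_
  calc (chainFunMap (dualChainMap α)).hom ≫ (chainFunDualIso Y).hom.hom
    _ = ((chainFunDualIsoKernel X).hom ≫ kerTensorChainMap α) ≫
        ((cokerPres (chainMor Y)).kernelIso (tensorFunctor A) (pres (chainFun Y))).hom :=
      (Category.assoc _ _ _).symm.trans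
        (congrArg (· ≫ _) (chainFunDualIsoKernel_naturality α))
    _ = (chainFunDualIso X).hom.hom ≫ (dMap (chainFunMap α)).hom := by
      rw [dMap_hom]
      exact (Category.assoc _ _ _).trans
        ((congrArg _ h_kernelIso.symm).trans (Category.assoc _ _ _).symm)

variable (A)

/-- The duality of chains induces the Auslander–Gruson–Jensen duality on the functors of chains. -/
def chainFunctorCompDIso :
    chainFunctor A ⋙ d A ≅ (chainDual A).rightOp ⋙ (chainFunctor Aᵐᵒᵖ).leftOp :=
  (NatIso.ofComponents chainFunDualIso chainFunDualIso_naturality).symm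

/-- The isomorphism of functors `d ∘ k⁻¹ ≅ k⁻¹ ∘ d_III`. -/
def kInvCompDIso : kInv A ⋙ d A ≅ (dIII A).rightOp ⋙ (kInv Aᵐᵒᵖ).leftOp :=
  CategoryTheory.Quotient.natIsoLift _ (chainFunctorCompDIso A)

end Duality

end AGJ

end

theorem proposition2p9 (A : Type u) [Ring A] :
    Nonempty ((AGJ.k A).rightOp ⋙ AGJ.dIII A ≅ (AGJ.d A).rightOp ⋙ AGJ.k Aᵐᵒᵖ) := by
  have h_square : CatCommSq (AGJ.kInv A).asEquivalence.functor (AGJ.dIII A).rightOp (AGJ.d A)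
      (AGJ.kInv Aᵐᵒᵖ).asEquivalence.leftOp.functor := ⟨AGJ.kInvCompDIso A⟩
  have h_inverse : AGJ.k A ⋙ (AGJ.dIII A).rightOp ≅ AGJ.d A ⋙ (AGJ.k Aᵐᵒᵖ).rightOp :=
    (CatCommSq.hInv _ _ _ _ h_square).iso
  exact ⟨NatIso.unop h_inverse.symm⟩
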